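/- An instance of Constrained Connectivity-Sum on the complete graph $K_n$ with vertex set $V$, $|V| = n$, consists of a safe set $S(u,v) \subseteq V$ with $u, v \in S(u,v)$ for every ordered pair $(u,v) \in V \times V$. A subgraph $H$ of $K_n$ is safely connected if for every pair $(u,v)$ there is a path in $H$ from $u$ to $v$ all of whose vertices lie in $S(u,v)$; the goal is to find a safely connected $H$ with as few edges as possible, and $\mathrm{OPT}$ denotes the minimum number of edges. Theorem. There is an $\tilde O(n^{2/3})$-approximation algorithm for Constrained Connectivity-Sum on $K_n$ that runs in time $\tilde O(n^6)$. Precisely: there are a randomized random-access program (with integer registers and arrays, addition, truncated subtraction, multiplication, comparisons and fair coin flips, each operation being charged proportionally to the bit lengths of the numbers involved) and constants $C$, $k$ such that for every $n \ge 2$ and every instance on $K_n$, given by $n$ and the table of the $n^3$ bits $[w \in S(u,v)]$, (a) for every outcome of the coin flips the program halts within time $C\, n^6 (\log n)^k$; and (b) with probability at least $1 - 1/n$ over the coin flips, the graph that it outputs (as an adjacency matrix) is safely connected and has at most $C\, n^{2/3} (\log n)^k \cdot \mathrm{OPT}$ edges. -/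

import Mathlib

namespace ConstrainedConnectivity

/-! ### The Constrained Connectivity-Sum problem -/

/-- A Constrained Connectivity instance on the vertex set `V`: an underlying graph and, for every
ordered pair `(u, v)`, a safe set containing `u` and `v`. -/
structure Instance (V : Type*) where
  graph : SimpleGraph V
  safe : V → V → Set V
  left_mem : ∀ u v, u ∈ safe u v
  right_mem : ∀ u v, v ∈ safe u v

/-- `H` is a subgraph of the underlying graph that contains, for every pair `(u, v)`, a path from
`u` to `v` all of whose vertices lie in the safe set of `(u, v)`. -/
def SafelyConnected {V : Type*} (I : Instance V) (H : SimpleGraph V) : Prop :=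
  H ≤ I.graph ∧
    ∀ u v : V, ∃ p : H.Walk u v, p.IsPath ∧ ∀ w ∈ p.support, w ∈ I.safe u v

/-- The minimum number of edges of a safely connected subgraph. -/
noncomputable def opt {V : Type*} (I : Instance V) : ℕ :=
  sInf {m : ℕ | ∃ H : SimpleGraph V, SafelyConnected I H ∧ H.edgeSet.ncard = m}

/-- On the complete graph the minimum defining `opt` is over a nonempty set. -/
theorem safelyConnected_top {V : Type*} (I : Instance V) (hI : I.graph = ⊤) :
    SafelyConnected I ⊤ := by
  refine ⟨hI ▸ le_rfl, fun u v => ?_⟩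
  by_cases h : u = v
  · subst h
    exact ⟨SimpleGraph.Walk.nil, by simp, by simpa using I.left_mem u u⟩
  · refine ⟨SimpleGraph.Walk.cons ((SimpleGraph.top_adj u v).2 h) SimpleGraph.Walk.nil, ?_, ?_⟩
    · simp [SimpleGraph.Walk.cons_isPath_iff, h]
    · simp [I.left_mem u v, I.right_mem u v]

/-! ### Randomized random-access programs with logarithmic cost

A machine has registers and random-access arrays, all holding natural numbers. A program mentions
only finitely many registers and array names. Every operation is charged one plus the bit length of
the number it produces; since operands are charged when they are evaluated, every operation is
charged at least the total bit length of all its operands, addresses and results. -/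

structure State where
  /-- contents of the registers -/
  reg : ℕ → ℕ
  /-- contents of the arrays: `arr a i` is cell `i` of array `a` -/
  arr : ℕ → ℕ → ℕ
  /-- number of random bits consumed so far -/
  used : ℕ

inductive Expr where
  | lit (k : ℕ)
  | reg (x : ℕ)
  | cell (a : ℕ) (i : Expr)
  | plus (e f : Expr)
  | minus (e f : Expr)
  | times (e f : Expr)
  | less (e f : Expr)
  | equal (e f : Expr)

namespace Expr

/-- The value of an expression; subtraction is truncated, tests give `0` or `1`. -/
def eval (s : State) : Expr → ℕ
  | lit k => k
  | reg x => s.reg x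
  | cell a i => s.arr a (eval s i)
  | plus e f => eval s e + eval s f
  | minus e f => eval s e - eval s f
  | times e f => eval s e * eval s f
  | less e f => if eval s e < eval s f then 1 else 0
  | equal e f => if eval s e = eval s f then 1 else 0

/-- The cost of evaluating an expression; `Nat.size` is the bit length. -/
def cost (s : State) : Expr → ℕ
  | lit k => Nat.size k + 1
  | reg x => Nat.size (s.reg x) + 1
  | cell a i => cost s i + Nat.size (s.arr a (eval s i)) + 1
  | plus e f => cost s e + cost s f + Nat.size (eval s e + eval s f) + 1
  | minus e f => cost s e + cost s f + Nat.size (eval s e - eval s f) + 1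
  | times e f => cost s e + cost s f + Nat.size (eval s e * eval s f) + 1
  | less e f => cost s e + cost s f + 2
  | equal e f => cost s e + cost s f + 2

end Expr

inductive Program where
  | skip
  /-- write the value of `e` into register `x` -/
  | assign (x : ℕ) (e : Expr)
  /-- write the value of `e` into cell `i` of array `a` -/
  | store (a : ℕ) (i e : Expr)
  /-- write a fresh fair random bit into register `x` -/
  | coin (x : ℕ)
  | seq (p q : Program)
  /-- run `p` if `e` is nonzero and `q` otherwise -/
  | branch (e : Expr) (p q : Program)
  /-- run `p` as long as `e` is nonzero -/
  | loop (e : Expr) (p : Program)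

/-- `Exec ω p s t s'`: with the random bits `ω`, the program `p` started in the state `s` halts
in the state `s'` after a computation of total cost `t`. -/
inductive Exec (ω : ℕ → Bool) : Program → State → ℕ → State → Prop
  | skip (s : State) : Exec ω Program.skip s 1 s
  | assign (x : ℕ) (e : Expr) (s : State) :
      Exec ω (Program.assign x e) s (e.cost s + 1)
        { s with reg := Function.update s.reg x (e.eval s) }
  | store (a : ℕ) (i e : Expr) (s : State) :
      Exec ω (Program.store a i e) s (i.cost s + e.cost s + 1)
        { s with
          arr := Function.update s.arr a (Function.update (s.arr a) (i.eval s) (e.eval s)) }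
  | coin (x : ℕ) (s : State) :
      Exec ω (Program.coin x) s 1
        { s with reg := Function.update s.reg x (if ω s.used then 1 else 0), used := s.used + 1 }
  | seq {p q : Program} {s s₁ s₂ : State} {t₁ t₂ : ℕ} :
      Exec ω p s t₁ s₁ → Exec ω q s₁ t₂ s₂ → Exec ω (Program.seq p q) s (t₁ + t₂) s₂
  | branch_true {e : Expr} {p q : Program} {s s₁ : State} {t : ℕ} :
      e.eval s ≠ 0 → Exec ω p s t s₁ → Exec ω (Program.branch e p q) s (e.cost s + 1 + t) s₁
  | branch_false {e : Expr} {p q : Program} {s s₁ : State} {t : ℕ} :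
      e.eval s = 0 → Exec ω q s t s₁ → Exec ω (Program.branch e p q) s (e.cost s + 1 + t) s₁
  | loop_done {e : Expr} {p : Program} {s : State} :
      e.eval s = 0 → Exec ω (Program.loop e p) s (e.cost s + 1) s
  | loop_step {e : Expr} {p : Program} {s s₁ s₂ : State} {t₁ t₂ : ℕ} :
      e.eval s ≠ 0 → Exec ω p s t₁ s₁ → Exec ω (Program.loop e p) s₁ t₂ s₂ →
      Exec ω (Program.loop e p) s (e.cost s + 1 + t₁ + t₂) s₂

/-- The law of an infinite sequence of independent fair random bits. -/
noncomputable def coinLaw : MeasureTheory.Measure (ℕ → Bool) :=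
  MeasureTheory.Measure.infinitePi fun _ : ℕ => (PMF.uniformOfFintype Bool).toMeasure

/-- The initial state on an instance with vertices `0, …, n - 1`: register `0` holds `n`,
array `0` holds the `n ^ 3` membership bits of the safe sets, and all else is `0`. -/
noncomputable def initial {n : ℕ} (I : Instance (Fin n)) : State where
  reg := fun x => if x = 0 then n else 0
  arr := fun a i =>
    open Classical in
    if a = 0 ∧ ∃ u v w : Fin n,
        i = ((u : ℕ) * n + (v : ℕ)) * n + (w : ℕ) ∧ w ∈ I.safe u v then 1 else 0
  used := 0

/-- The graph on `0, …, n - 1` that a state represents: its adjacency matrix is read, row by row,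
from array `1`; two distinct vertices are adjacent if at least one of their two entries is
nonzero. -/
def output (n : ℕ) (s : State) : SimpleGraph (Fin n) :=
  SimpleGraph.fromRel fun u v => s.arr 1 ((u : ℕ) * n + (v : ℕ)) ≠ 0

end ConstrainedConnectivity

/-! The program is deterministic and splits the pairs by the size of their safe set `S`, with
threshold `n ^ (1/3)`.

Thin pairs are treated one after another. Let `D` be the current set of edges and `T` the component
of `u` in `D` restricted to `S`. If `v` is not in `T`, all pairs in `T × (S \ T)` are added; the
edge `uv` is among them, so the pair becomes connected. Every feasible `G` contains a path from `u`
to `v` inside `S`, and this path crosses from `T` to `S \ T` along an edge of `G` that is in the new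
set but not in `D`. Each addition of at most `|S| ^ 2 ≤ n ^ (2/3)` pairs thus pays for itself with a
new edge of an optimal solution (`Economical.fillCut`), and at most `n ^ (2/3) * OPT` pairs are
added in all.

Thick pairs are connected by stars: a star at a vertex of `S` joins `u` to `v` within `S`. Centres
are chosen greedily. By double counting, some vertex lies in at least a fraction `n ^ (-2/3)` of the
safe sets of the remaining pairs (`card_le_mul_hits`), so at most `2 * n ^ (2/3) * log n + 1` stars
are needed (`le_log_of_one_le`, `addStars_spec`). Each costs `n` pairs, and `OPT ≥ n - 1 ≥ n / 2`
because a feasible graph is connected.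

For the running time, the program is written in a language of loops of length `n` whose steps raise
the largest stored number by at most one. All stored numbers are then polynomial in `n`, every
expression costs `O(log n)`, and the depth of loop nesting gives the exponent of `n`
(`Cmd.exec_compile`, `Cmd.exec_initial`). -/

namespace ConstrainedConnectivity

/-! ### A sublanguage with bounded loops -/

/-- Programs with bounded loops in which each step increases the largest stored number by at most
one. -/
inductive Cmd where
  | clear (x : ℕ)
  | copy (x y : ℕ)
  /-- add one to register `x` if `e` is nonzero -/
  | tally (x : ℕ) (e : Expr)
  /-- write into cell `i` of array `a` whether `e` is nonzero -/
  | mark (a : ℕ) (i e : Expr)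
  | seq (p q : Cmd)
  /-- run `p` if `e` is nonzero -/
  | cond (e : Expr) (p : Cmd)
  /-- run `p` for each value of register `x` smaller than register `0` -/
  | each (x : ℕ) (p : Cmd)

def State.setReg (s : State) (x k : ℕ) : State :=
  { s with reg := Function.update s.reg x k }

def State.setCell (s : State) (a i k : ℕ) : State :=
  { s with arr := Function.update s.arr a (Function.update (s.arr a) i k) }

namespace Cmd

def compile : Cmd → Program
  | clear x => .assign x (.lit 0)
  | copy x y => .assign x (.reg y)
  | tally x e => .assign x (.plus (.reg x) (.less (.lit 0) e))
  | mark a i e => .store a i (.less (.lit 0) e)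
  | seq p q => .seq p.compile q.compile
  | cond e p => .branch e p.compile .skip
  | each x p => .seq (.assign x (.lit 0))
      (.loop (.less (.reg x) (.reg 0)) (.seq p.compile (.assign x (.plus (.reg x) (.lit 1)))))

/-- The state in which a program halts. -/
def den : Cmd → State → State
  | clear x, s => s.setReg x 0
  | copy x y, s => s.setReg x (s.reg y)
  | tally x e, s => s.setReg x (s.reg x + if 0 < e.eval s then 1 else 0)
  | mark a i e, s => s.setCell a (i.eval s) (if 0 < e.eval s then 1 else 0)
  | seq p q, s => q.den (p.den s)
  | cond e p, s => if e.eval s ≠ 0 then p.den s else s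
  | each x p, s =>
      (fun s => (p.den s).setReg x ((p.den s).reg x + 1))^[s.reg 0] (s.setReg x 0)

/-- The registers that a program may change. -/
def regs : Cmd → List ℕ
  | clear x => [x]
  | copy x _ => [x]
  | tally x _ => [x]
  | mark _ _ _ => []
  | seq p q => p.regs ++ q.regs
  | cond _ p => p.regs
  | each x p => x :: p.regs

/-- The arrays that a program may change. -/
def arrs : Cmd → List ℕ
  | clear _ => []
  | copy _ _ => []
  | tally _ _ => []
  | mark a _ _ => [a]
  | seq p q => p.arrs ++ q.arrs
  | cond _ p => p.arrs
  | each _ p => p.arrs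

/-- No loop changes its own counter or register `0` in its body. -/
def WellFormed : Cmd → Prop
  | clear _ => True
  | copy _ _ => True
  | tally _ _ => True
  | mark _ _ _ => True
  | seq p q => p.WellFormed ∧ q.WellFormed
  | cond _ p => p.WellFormed
  | each x p => x ≠ 0 ∧ x ∉ p.regs ∧ 0 ∉ p.regs ∧ p.WellFormed

theorem den_reg (p : Cmd) {s : State} {r : ℕ} (hr : r ∉ p.regs) : (p.den s).reg r = s.reg r := by
  induction p generalizing s with
  | clear x | copy x _ | tally x _ =>
    simp only [regs, List.mem_singleton] at hr
    simp [den, State.setReg, hr]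
  | mark a i e => simp [den, State.setCell]
  | seq p q hp hq =>
    simp only [regs, List.mem_append, not_or] at hr
    simp [den, hp hr.1, hq hr.2]
  | cond e p hp =>
    simp only [regs] at hr
    simp only [den]
    split_ifs
    · exact hp hr
    · rfl
  | each x p hp =>
    simp only [regs, List.mem_cons, not_or] at hr
    simp only [den]
    generalize s.reg 0 = m
    induction m with
    | zero => simp [State.setReg, hr.1]
    | succ m ih =>
      rw [Function.iterate_succ_apply']
      simp [State.setReg, hr.1, hp hr.2] at ih ⊢
      exact ih

theorem den_arr (p : Cmd) {s : State} {a : ℕ} (ha : a ∉ p.arrs) : (p.den s).arr a = s.arr a := by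
  induction p generalizing s with
  | clear x | copy x _ | tally x _ => simp [den, State.setReg]
  | mark a i e =>
    simp only [arrs, List.mem_singleton] at ha
    simp [den, State.setCell, ha]
  | seq p q hp hq =>
    simp only [arrs, List.mem_append, not_or] at ha
    simp [den, hp ha.1, hq ha.2]
  | cond e p hp =>
    simp only [arrs] at ha
    simp only [den]
    split_ifs
    · exact hp ha
    · rfl
  | each x p hp =>
    simp only [arrs] at ha
    simp only [den]
    generalize s.reg 0 = m
    induction m with
    | zero => simp [State.setReg]
    | succ m ih =>
      rw [Function.iterate_succ_apply']
      simp [State.setReg, hp ha] at ih ⊢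
      exact ih

/-- The state after `m` rounds of a bounded loop. -/
def rounds (x : ℕ) (p : Cmd) (m : ℕ) (s : State) : State :=
  (fun s => (p.den s).setReg x ((p.den s).reg x + 1))^[m] (s.setReg x 0)

theorem rounds_succ (x : ℕ) (p : Cmd) (m : ℕ) (s : State) :
    rounds x p (m + 1) s = (p.den (rounds x p m s)).setReg x ((p.den (rounds x p m s)).reg x + 1) :=
  Function.iterate_succ_apply' _ _ _

theorem rounds_counter {x : ℕ} {p : Cmd} (hx : x ∉ p.regs) (m : ℕ) (s : State) :
    (rounds x p m s).reg x = m := by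
  induction m with
  | zero => simp [rounds, State.setReg]
  | succ m ih => simp [rounds_succ, State.setReg, den_reg p hx, ih]

theorem rounds_reg {x : ℕ} {p : Cmd} (m : ℕ) (s : State) {r : ℕ} (hr : r ∉ (each x p).regs) :
    (rounds x p m s).reg r = s.reg r := by
  simp only [regs, List.mem_cons, not_or] at hr
  induction m with
  | zero => simp [rounds, State.setReg, hr.1]
  | succ m ih => simp [rounds_succ, State.setReg, hr.1, den_reg p hr.2, ih]

theorem rounds_arr {x : ℕ} {p : Cmd} (m : ℕ) (s : State) {a : ℕ} (ha : a ∉ (each x p).arrs) :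
    (rounds x p m s).arr a = s.arr a := by
  simp only [arrs] at ha
  induction m with
  | zero => simp [rounds, State.setReg]
  | succ m ih => simp [rounds_succ, State.setReg, den_arr p ha, ih]

/-- The invariant rule for bounded loops. -/
theorem den_each {x : ℕ} {p : Cmd} {s : State} {n : ℕ} (Inv : ℕ → State → Prop)
    (hx : x ∉ p.regs) (hn : s.reg 0 = n)
    (hset : ∀ i s k, Inv i s → Inv i (s.setReg x k)) (h0 : Inv 0 s)
    (hstep : ∀ i < n, ∀ s' : State, s'.reg x = i →
      (∀ r, r ∉ (each x p).regs → s'.reg r = s.reg r) →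
      (∀ a, a ∉ (each x p).arrs → s'.arr a = s.arr a) → Inv i s' → Inv (i + 1) (p.den s')) :
    Inv n ((each x p).den s) := by
  -- `rounds` clears the counter before the first round and increments it after each round; `hset`
  -- makes the invariant insensitive to both.
  have key : ∀ m ≤ n, Inv m (rounds x p m s) := by
    intro m
    induction m with
    | zero => exact fun _ => hset _ _ _ h0
    | succ m ih =>
      intro hm
      rw [rounds_succ]
      exact hset _ _ _ (hstep m hm _ (rounds_counter hx m s) (fun r => rounds_reg m s)
        (fun a => rounds_arr m s) (ih (by omega)))
  have := key n le_rfl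
  rwa [den, hn]

/-! ### Running time -/

/-- A bound for the number of elementary steps. -/
def steps (n : ℕ) : Cmd → ℕ
  | clear _ => 1
  | copy _ _ => 1
  | tally _ _ => 1
  | mark _ _ _ => 1
  | seq p q => p.steps n + q.steps n
  | cond _ p => p.steps n
  | each _ p => n * (p.steps n + 1)

end Cmd

/-- All numbers stored in a state are at most `M`. -/
def State.Bounded (M : ℕ) (s : State) : Prop :=
  (∀ r, s.reg r ≤ M) ∧ ∀ a i, s.arr a i ≤ M

theorem State.Bounded.mono {M N : ℕ} {s : State} (h : s.Bounded M) (hMN : M ≤ N) : s.Bounded N :=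
  ⟨fun r => (h.1 r).trans hMN, fun a i => (h.2 a i).trans hMN⟩

theorem State.Bounded.setReg {M : ℕ} {s : State} (h : s.Bounded M) {x k : ℕ} (hk : k ≤ M) :
    (s.setReg x k).Bounded M := by
  refine ⟨fun r => ?_, h.2⟩
  by_cases hr : r = x
  · subst hr; simpa [State.setReg] using hk
  · simpa [State.setReg, hr] using h.1 r

theorem State.Bounded.setCell {M : ℕ} {s : State} (h : s.Bounded M) {a i k : ℕ} (hk : k ≤ M) :
    (s.setCell a i k).Bounded M := by
  refine ⟨h.1, fun b j => ?_⟩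
  by_cases hb : b = a
  · subst hb
    by_cases hj : j = i
    · subst hj; simpa [State.setCell] using hk
    · simpa [State.setCell, hj] using h.2 b j
  · simpa [State.setCell, hb] using h.2 b j

theorem Cmd.rounds_bounded {x n M c : ℕ} {p : Cmd} {s : State}
    (hr : 0 ∉ (each x p).regs) (hn : s.reg 0 = n) (hs : s.Bounded M)
    (hp : ∀ s' N, s'.reg 0 = n → s'.Bounded N → (p.den s').Bounded (N + c)) (m : ℕ) :
    (rounds x p m s).Bounded (M + m * (c + 1)) := by
  induction m with
  | zero => exact (hs.mono (by simp)).setReg (Nat.zero_le _)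
  | succ m ih =>
    have h := hp _ _ ((rounds_reg m s hr).trans hn) ih
    rw [rounds_succ]
    have e : M + (m + 1) * (c + 1) = M + m * (c + 1) + c + 1 := by ring
    rw [e]
    exact (h.mono (Nat.le_succ _)).setReg (Nat.succ_le_succ (h.1 x))

/-- An elementary step raises the maximum by at most one, and `steps` also counts the increments of
the loop counters. This keeps bit lengths logarithmic, although intermediate values of expressions
may be larger. -/
theorem Cmd.den_bounded {n : ℕ} (p : Cmd) {s : State} {M : ℕ} (hp : p.WellFormed)
    (hn : s.reg 0 = n) (h0 : 0 ∉ p.regs) (hs : s.Bounded M) :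
    (p.den s).Bounded (M + p.steps n) := by
  induction p generalizing s M with
  | clear x => exact (hs.mono (by simp)).setReg (by simp)
  | copy x y => exact (hs.mono (by simp)).setReg ((hs.1 y).trans (by simp))
  | tally x e =>
    refine (hs.mono (by simp)).setReg ?_
    have := hs.1 x
    simp only [Cmd.steps]
    split_ifs <;> omega
  | mark a i e =>
    refine (hs.mono (by simp)).setCell ?_
    simp only [Cmd.steps]
    split_ifs <;> omega
  | seq p q ihp ihq =>
    simp only [Cmd.regs, List.mem_append, not_or] at h0
    rw [Cmd.steps, ← add_assoc]
    exact ihq hp.2 (by rw [Cmd.den_reg p h0.1, hn]) h0.2 (ihp hp.1 hn h0.1 hs)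
  | cond e p ih =>
    simp only [Cmd.den]
    split_ifs
    · exact ih hp hn h0 hs
    · exact hs.mono (by simp)
  | each x p ih =>
    have hr := h0
    simp only [Cmd.regs, List.mem_cons, not_or] at h0
    simp only [Cmd.den, hn, Cmd.steps]
    exact Cmd.rounds_bounded hr hn hs (fun s' N h hs' => ih hp.2.2.2 h h0.2 hs') n

/-! ### Logarithmic cost of expressions -/

namespace Expr

/-- A number `d` such that all values are at most `(M + 2) ^ d` if the state is bounded by `M`. -/
def degree : Expr → ℕ
  | lit k => k + 1
  | reg _ => 1
  | cell _ _ => 1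
  | plus e f => e.degree + f.degree
  | minus e _ => e.degree
  | times e f => e.degree + f.degree
  | less _ _ => 1
  | equal _ _ => 1

/-- The cost of an expression in multiples of the bit length of the stored numbers. -/
def weight : Expr → ℕ
  | lit k => k + 2
  | reg _ => 2
  | cell _ i => i.weight + 2
  | plus e f => e.weight + f.weight + (e.degree + f.degree) + 1
  | minus e f => e.weight + f.weight + e.degree + 1
  | times e f => e.weight + f.weight + (e.degree + f.degree) + 1
  | less e f => e.weight + f.weight + 2
  | equal e f => e.weight + f.weight + 2

theorem degree_pos (e : Expr) : 0 < e.degree := by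
  induction e <;> simp_all [degree]

/-- The base `M + 2` is at least two, so a literal `k` is below a power of exponent `k + 1`, and a
sum of two powers of positive exponent is at most their product. -/
theorem eval_le {s : State} {M : ℕ} (hs : s.Bounded M) (e : Expr) :
    e.eval s ≤ (M + 2) ^ e.degree := by
  have two_le : ∀ d, 0 < d → 2 ≤ (M + 2) ^ d := fun d hd =>
    (by omega : 2 ≤ M + 2).trans (Nat.le_self_pow hd.ne' _)
  induction e with
  | lit k =>
    calc k ≤ 2 ^ (k + 1) := (Nat.lt_two_pow_self.le).trans (Nat.pow_le_pow_right (by simp) (by simp))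
      _ ≤ (M + 2) ^ (k + 1) := Nat.pow_le_pow_left (by simp) _
  | reg x => simpa [eval, degree] using (hs.1 x).trans (Nat.le_add_right _ _)
  | cell a i => simpa [eval, degree] using (hs.2 a _).trans (Nat.le_add_right _ _)
  | plus e f he hf =>
    rw [eval, degree, pow_add]
    have h1 := two_le _ e.degree_pos
    have h2 := two_le _ f.degree_pos
    nlinarith
  | minus e f he hf => exact (Nat.sub_le _ _).trans he
  | times e f he hf =>
    rw [eval, degree, pow_add]
    exact Nat.mul_le_mul he hf
  | less e f | equal e f =>
    simp only [eval, degree, pow_one]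
    split_ifs <;> omega

theorem size_eval_le {s : State} {M : ℕ} (hs : s.Bounded M) (e : Expr) :
    Nat.size (e.eval s) ≤ e.degree * Nat.size (M + 2) := by
  rw [Nat.size_le, mul_comm, pow_mul]
  exact (eval_le hs e).trans_lt (Nat.pow_lt_pow_left (Nat.lt_size_self _) e.degree_pos.ne')

theorem cost_le {s : State} {M : ℕ} (hs : s.Bounded M) (e : Expr) :
    e.cost s ≤ e.weight * Nat.size (M + 2) := by
  have hL : 1 ≤ Nat.size (M + 2) := Nat.size_pos.2 (by simp)
  induction e with
  | lit k =>
    have h := size_eval_le hs (lit k)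
    simp only [eval, degree, cost, weight] at h ⊢
    nlinarith
  | reg x =>
    have h := size_eval_le hs (reg x)
    simp only [eval, degree, cost, weight] at h ⊢
    nlinarith
  | cell a i hi =>
    have h := size_eval_le hs (cell a i)
    simp only [eval, degree, cost, weight] at h ⊢
    nlinarith
  | plus e f he hf =>
    have h := size_eval_le hs (plus e f)
    simp only [eval, degree, cost, weight] at h ⊢
    nlinarith
  | minus e f he hf =>
    have h := size_eval_le hs (minus e f)
    simp only [eval, degree, cost, weight] at h ⊢
    nlinarith
  | times e f he hf =>
    have h := size_eval_le hs (times e f)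
    simp only [eval, degree, cost, weight] at h ⊢
    nlinarith
  | less e f he hf | equal e f he hf =>
    simp only [cost, weight]
    nlinarith

end Expr

/-! ### Running time of compiled programs -/

namespace Cmd

/-- A bound for the running time in multiples of the bit length of the stored numbers. -/
def work (n : ℕ) : Cmd → ℕ
  | clear _ => (Expr.lit 0).weight + 1
  | copy _ y => (Expr.reg y).weight + 1
  | tally x e => (Expr.plus (.reg x) (.less (.lit 0) e)).weight + 1
  | mark _ i e => i.weight + (Expr.less (.lit 0) e).weight + 1
  | seq p q => p.work n + q.work n
  | cond e p => e.weight + 2 + p.work n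
  | each x p => ((Expr.lit 0).weight + 1) + ((Expr.less (.reg x) (.reg 0)).weight + 1) +
      n * ((Expr.less (.reg x) (.reg 0)).weight + 1 + p.work n +
        ((Expr.plus (.reg x) (.lit 1)).weight + 1))

/-- The number `B` bounds everything stored during the whole run, so that a single factor `Nat.size
(B + 2)` serves every step and the induction only has to add up weights. -/
theorem exec_compile (ω : ℕ → Bool) {n B : ℕ} (p : Cmd) {s : State} {M : ℕ} (hp : p.WellFormed)
    (hn : s.reg 0 = n) (h0 : 0 ∉ p.regs) (hs : s.Bounded M) (hB : M + p.steps n ≤ B) :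
    ∃ t, Exec ω p.compile s t (p.den s) ∧ t ≤ p.work n * Nat.size (B + 2) := by
  have hL : 1 ≤ Nat.size (B + 2) := Nat.size_pos.2 (by simp)
  induction p generalizing s M with
  | clear x =>
    exact ⟨_, Exec.assign x _ s, by have := Expr.cost_le (hs.mono (by omega : M ≤ B)) (.lit 0)
                                    simp only [work]; nlinarith⟩
  | copy x y =>
    exact ⟨_, Exec.assign x _ s, by have := Expr.cost_le (hs.mono (by omega : M ≤ B)) (.reg y)
                                    simp only [work]; nlinarith⟩
  | tally x e =>
    exact ⟨_, Exec.assign x _ s, by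
      have := Expr.cost_le (hs.mono (by omega : M ≤ B)) (.plus (.reg x) (.less (.lit 0) e))
      simp only [work]; nlinarith⟩
  | mark a i e =>
    exact ⟨_, Exec.store a _ _ s, by
      have h1 := Expr.cost_le (hs.mono (by omega : M ≤ B)) (.less (.lit 0) e)
      have h2 := Expr.cost_le (hs.mono (by omega : M ≤ B)) i
      simp only [work]; nlinarith⟩
  | seq p q ihp ihq =>
    simp only [regs, List.mem_append, not_or] at h0
    simp only [steps] at hB
    obtain ⟨t₁, e₁, h₁⟩ := ihp hp.1 hn h0.1 hs (by omega)
    obtain ⟨t₂, e₂, h₂⟩ := ihq hp.2 ((den_reg p h0.1).trans hn) h0.2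
      (den_bounded p hp.1 hn h0.1 hs) (by omega)
    exact ⟨_, e₁.seq e₂, by simp only [work]; nlinarith⟩
  | cond e p ih =>
    have hc := Expr.cost_le (hs.mono (by omega : M ≤ B)) e
    by_cases he : e.eval s = 0
    · exact ⟨_, by simpa [den, compile, he] using Exec.branch_false he (Exec.skip s), by
        simp only [work]; nlinarith [Nat.zero_le (p.work n * Nat.size (B + 2))]⟩
    · obtain ⟨t, et, ht⟩ := ih hp hn h0 hs hB
      exact ⟨_, by simpa [den, compile, he] using Exec.branch_true he et, by simp only [work]; nlinarith⟩
  | each x p ih =>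
    have hr := h0
    simp only [regs, List.mem_cons, not_or] at h0
    simp only [steps] at hB
    have bdd := rounds_bounded (c := p.steps n) hr hn hs
      fun s' N h hs' => den_bounded p hp.2.2.2 h h0.2 hs'
    have reg0 : ∀ m, (rounds x p m s).reg 0 = n := fun m => (rounds_reg m s hr).trans hn
    have le_B : ∀ m ≤ n, M + m * (p.steps n + 1) ≤ B := fun m hm =>
      (Nat.add_le_add_left (Nat.mul_le_mul_right _ hm) _).trans hB
    have guard : ∀ m ≤ n, (Expr.less (.reg x) (.reg 0)).cost (rounds x p m s) ≤
        (Expr.less (.reg x) (.reg 0)).weight * Nat.size (B + 2) := fun m hm =>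
      Expr.cost_le ((bdd m).mono (le_B m hm)) _
    -- Induction on the number `d` of rounds still to come, since `Exec.loop_step` peels off the
    -- first of them.
    have main : ∀ d m, m + d = n → ∃ t,
        Exec ω (.loop (.less (.reg x) (.reg 0))
          (.seq p.compile (.assign x (.plus (.reg x) (.lit 1))))) (rounds x p m s) t
          (rounds x p n s) ∧
        t ≤ ((Expr.less (.reg x) (.reg 0)).weight + 1 + d *
          ((Expr.less (.reg x) (.reg 0)).weight + 1 + p.work n +
            ((Expr.plus (.reg x) (.lit 1)).weight + 1))) * Nat.size (B + 2) := by
      intro d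
      induction d with
      | zero =>
        rintro m rfl
        have := guard m le_rfl
        exact ⟨_, Exec.loop_done (by simp [Expr.eval, rounds_counter hp.2.1, reg0]), by nlinarith⟩
      | succ d ihd =>
        intro m hm
        have h1 : M + (m + 1) * (p.steps n + 1) ≤ B := le_B _ (by omega)
        obtain ⟨t₁, e₁, h₁⟩ := ih hp.2.2.2 (reg0 m) h0.2 (bdd m) (by nlinarith)
        obtain ⟨t₂, e₂, h₂⟩ := ihd (m + 1) (by omega)
        have hb := den_bounded p hp.2.2.2 (reg0 m) h0.2 (bdd m)
        have hinc := Expr.cost_le (hb.mono (by nlinarith : _ ≤ B)) (.plus (.reg x) (.lit 1))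
        have hg := guard m (by omega)
        refine ⟨_, Exec.loop_step (by simp [Expr.eval, rounds_counter hp.2.1, reg0]; omega)
          (e₁.seq (Exec.assign x _ _)) (by rw [rounds_succ] at e₂; exact e₂), ?_⟩
        nlinarith
    obtain ⟨t, et, ht⟩ := main n 0 (by simp)
    have hz := Expr.cost_le (hs.mono (by omega : M ≤ B)) (.lit 0)
    refine ⟨(Expr.lit 0).cost s + 1 + t, ?_, ?_⟩
    · rw [den, hn]
      exact (Exec.assign x (.lit 0) s).seq et
    · simp only [work]
      nlinarith

/-- The nesting depth of the loops. -/
def depth : Cmd → ℕ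
  | clear _ | copy _ _ | tally _ _ | mark _ _ _ => 0
  | seq p q => max p.depth q.depth
  | cond _ p => p.depth
  | each _ p => p.depth + 1

/-- Each loop multiplies the work by `n`; the constant overheads are absorbed because `1 ≤ n`. -/
theorem exists_work_le (p : Cmd) : ∃ K, ∀ n, 1 ≤ n → p.work n ≤ K * n ^ p.depth := by
  induction p with
  | clear x => exact ⟨_, fun n _ => by simp only [work, depth, pow_zero, mul_one]; exact le_rfl⟩
  | copy x y => exact ⟨_, fun n _ => by simp only [work, depth, pow_zero, mul_one]; exact le_rfl⟩
  | tally x e => exact ⟨_, fun n _ => by simp only [work, depth, pow_zero, mul_one]; exact le_rfl⟩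
  | mark a i e => exact ⟨_, fun n _ => by simp only [work, depth, pow_zero, mul_one]; exact le_rfl⟩
  | seq p q hp hq =>
    obtain ⟨K, hK⟩ := hp
    obtain ⟨K', hK'⟩ := hq
    refine ⟨K + K', fun n hn => ?_⟩
    rw [add_mul]
    exact Nat.add_le_add
      ((hK n hn).trans (Nat.mul_le_mul_left _ (Nat.pow_le_pow_right hn (le_max_left _ _))))
      ((hK' n hn).trans (Nat.mul_le_mul_left _ (Nat.pow_le_pow_right hn (le_max_right _ _))))
  | cond e p hp =>
    obtain ⟨K, hK⟩ := hp
    refine ⟨e.weight + 2 + K, fun n hn => ?_⟩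
    have := hK n hn
    have h1 : 1 ≤ n ^ p.depth := Nat.one_le_pow _ _ hn
    simp only [work, depth]
    nlinarith
  | each x p hp =>
    obtain ⟨K, hK⟩ := hp
    refine ⟨((Expr.lit 0).weight + 1) + ((Expr.less (.reg x) (.reg 0)).weight + 1) +
      ((Expr.less (.reg x) (.reg 0)).weight + 1 + K +
        ((Expr.plus (.reg x) (.lit 1)).weight + 1)), fun n hn => ?_⟩
    have h := Nat.mul_le_mul_left n (hK n hn)
    have h1 : 1 ≤ n ^ p.depth := Nat.one_le_pow _ _ hn
    have h2 : n ≤ n * n ^ p.depth := Nat.le_mul_of_pos_right _ h1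
    simp only [work, depth, pow_succ]
    generalize (Expr.lit 0).weight + 1 = a at *
    generalize (Expr.less (.reg x) (.reg 0)).weight + 1 = b at *
    generalize (Expr.plus (.reg x) (.lit 1)).weight + 1 = c at *
    have h3 := Nat.mul_le_mul_left (a + b) (hn.trans h2)
    have h4 := Nat.mul_le_mul_left (b + c) h2
    nlinarith

theorem steps_le_work (n : ℕ) (p : Cmd) : p.steps n ≤ p.work n := by
  induction p with
  | clear x | copy x y | tally x e | mark a i e => simp [steps, work]
  | seq p q hp hq => exact Nat.add_le_add hp hq
  | cond e p hp => exact hp.trans (Nat.le_add_left _ _)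
  | each x p hp =>
    refine (Nat.mul_le_mul_left n ?_).trans (Nat.le_add_left _ _)
    omega

end Cmd

/-! ### Time bound on problem instances -/

theorem initial_bounded {n : ℕ} (hn : 1 ≤ n) (I : Instance (Fin n)) : (initial I).Bounded n := by
  refine ⟨fun r => ?_, fun a i => ?_⟩ <;> simp only [initial] <;> split_ifs <;> omega

/-- A positive number of bit length `b` is at least `2 ^ (b - 1)`. Since `log n ≥ log 2`, the
additive constants become multiples of `log n`. -/
theorem size_le_log {K n : ℕ} (hn : 2 ≤ n) (d : ℕ) :
    (Nat.size ((K + 1) * n ^ d) : ℝ) ≤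
      ((Real.log (K + 1) / Real.log 2 + d + 1) / Real.log 2) * Real.log n := by
  have hlog2 : 0 < Real.log 2 := Real.log_pos one_lt_two
  have hlog : Real.log 2 ≤ Real.log n := Real.log_le_log two_pos (by exact_mod_cast hn)
  have hK : 0 ≤ Real.log (K + 1) := Real.log_nonneg (by simp)
  have hpos : (K + 1) * n ^ d ≠ 0 := by positivity
  have h1 : (2 : ℝ) ^ (Nat.size ((K + 1) * n ^ d) - 1) ≤ (K + 1) * n ^ d := by
    have : 2 ^ (Nat.size ((K + 1) * n ^ d) - 1) ≤ (K + 1) * n ^ d :=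
      Nat.lt_size.1 (Nat.sub_lt (Nat.size_pos.2 (Nat.pos_of_ne_zero hpos)) one_pos)
    exact_mod_cast this
  have h2 := Real.log_le_log (by positivity) h1
  have hn0 : (n : ℝ) ≠ 0 := by positivity
  rw [Real.log_pow, Real.log_mul (by positivity) (by positivity), Real.log_pow,
    Nat.cast_pred (Nat.size_pos.2 (Nat.pos_of_ne_zero hpos))] at h2
  have h3 : Real.log (K + 1) ≤ Real.log (K + 1) / Real.log 2 * Real.log n := by
    rw [div_mul_eq_mul_div, le_div_iff₀ hlog2]
    gcongr
  rw [div_mul_eq_mul_div, le_div_iff₀ hlog2]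
  linarith

/-- A program with loops nested to depth at most `d` runs in time `O(n ^ d * log n)`. -/
theorem Cmd.exec_initial (p : Cmd) (hp : p.WellFormed) (h0 : 0 ∉ p.regs) {d : ℕ}
    (hd : p.depth ≤ d) :
    ∃ C : ℝ, ∀ n : ℕ, 2 ≤ n → ∀ (I : Instance (Fin n)) (ω : ℕ → Bool), ∃ t,
      Exec ω p.compile (initial I) t (p.den (initial I)) ∧
      (t : ℝ) ≤ C * (n : ℝ) ^ d * Real.log n := by
  obtain ⟨K, hK⟩ := p.exists_work_le
  obtain ⟨D, hD⟩ : ∃ D : ℝ, ∀ n : ℕ, 2 ≤ n →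
      (Nat.size ((K + 2 + 1) * n ^ (d + 1)) : ℝ) ≤ D * Real.log n :=
    ⟨_, fun n hn => size_le_log hn (d + 1)⟩
  refine ⟨K * D, fun n hn I ω => ?_⟩
  have hw : p.work n ≤ K * n ^ d :=
    (hK n (by omega)).trans (Nat.mul_le_mul_left _ (Nat.pow_le_pow_right (by omega) hd))
  obtain ⟨t, et, ht⟩ := p.exec_compile ω (n := n) (B := n + p.steps n) hp (by simp [initial]) h0
    (initial_bounded (by omega) I) le_rfl
  have hB : n + p.steps n + 2 ≤ (K + 2 + 1) * n ^ (d + 1) := by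
    have h1 := (steps_le_work n p).trans hw
    have h2 : n ^ d ≤ n ^ (d + 1) := Nat.pow_le_pow_right (by omega) (by omega)
    have h3 : n ≤ n ^ (d + 1) := Nat.le_self_pow (by omega) n
    nlinarith
  have ht' : (t : ℝ) ≤ (K * n ^ d : ℕ) * (Nat.size ((K + 2 + 1) * n ^ (d + 1)) : ℝ) := by
    exact_mod_cast ht.trans (Nat.mul_le_mul hw (Nat.size_le_size hB))
  refine ⟨t, et, ht'.trans ?_⟩
  push_cast
  rw [mul_assoc (K : ℝ) D, mul_right_comm, mul_right_comm, mul_assoc (K : ℝ), mul_assoc (K : ℝ)]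
  have := hD n hn
  rw [mul_right_comm D, mul_comm ((n : ℝ) ^ d)]
  gcongr

/-! ### The program -/

namespace Algorithm

/-- The address of the pair held in registers `x` and `y`. -/
def pairIndex (x y : ℕ) : Expr := .plus (.times (.reg x) (.reg 0)) (.reg y)

/-- Whether the vertex in register `y` is in the safe set of the pair in registers `1` and `2`. -/
def inSafe (y : ℕ) : Expr := .cell 0 (.plus (.times (pairIndex 1 2) (.reg 0)) (.reg y))

/-- Compute the size of the safe set in register `3`. -/
def countSafe : Cmd := .seq (.clear 3) (.each 4 (.tally 3 (inSafe 4)))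

/-- Whether the safe set has more than `n ^ (1 / 3)` elements. -/
def isThick : Expr := .less (.reg 0) (.times (.reg 3) (.times (.reg 3) (.reg 3)))

/-- Add to the vertex set in array `2` all its neighbours in the safe set. -/
def growPass : Cmd :=
  .each 6 (.each 7 (.cond
    (.times (.cell 2 (.reg 6)) (.times (inSafe 7)
      (.plus (.cell 1 (pairIndex 6 7)) (.cell 1 (pairIndex 7 6)))))
    (.mark 2 (.reg 7) (.lit 1))))

/-- Compute in array `2` the component of the vertex in register `1` within the safe set. -/
def component : Cmd :=
  .seq (.each 6 (.mark 2 (.reg 6) (.equal (.reg 6) (.reg 1)))) (.each 5 growPass)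

/-- Add all edges between array `2` and the rest of the safe set. -/
def fillCut : Cmd :=
  .each 6 (.each 7 (.cond
    (.times (.cell 2 (.reg 6)) (.times (inSafe 7) (.equal (.cell 2 (.reg 7)) (.lit 0))))
    (.mark 1 (pairIndex 6 7) (.lit 1))))

/-- Connect the pair in registers `1` and `2` if its safe set is small, and record the pair in
array `3` if its safe set is large. -/
def treatPair : Cmd :=
  .seq countSafe (.seq (.mark 3 (pairIndex 1 2) isThick) (.seq component
    (.cond (.times (.equal isThick (.lit 0)) (.equal (.cell 2 (.reg 2)) (.lit 0))) fillCut)))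

def treatPairs : Cmd := .each 1 (.each 2 treatPair)

/-- Compute in register `3` the number of recorded pairs whose safe set contains the vertex in
register `4`. -/
def countHits : Cmd :=
  .seq (.clear 3) (.each 1 (.each 2 (.tally 3 (.times (.cell 3 (pairIndex 1 2)) (inSafe 4)))))

/-- Find in register `9` a vertex in as many safe sets of recorded pairs as possible, and their
number in register `8`. -/
def findBest : Cmd :=
  .seq (.clear 8) (.seq (.clear 9)
    (.each 4 (.seq countHits (.cond (.less (.reg 8) (.reg 3)) (.seq (.copy 8 3) (.copy 9 4))))))

/-- Add the star at the vertex in register `9` and discard the recorded pairs that it connects. -/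
def addStar : Cmd :=
  .seq (.each 6 (.mark 1 (pairIndex 9 6) (.lit 1)))
    (.each 1 (.each 2 (.mark 3 (pairIndex 1 2)
      (.times (.cell 3 (pairIndex 1 2)) (.equal (inSafe 9) (.lit 0))))))

def starRound : Cmd := .seq findBest (.cond (.reg 8) addStar)

def addStars : Cmd := .each 10 (.each 11 starRound)

def main : Cmd := .seq treatPairs addStars

theorem main_wellFormed : main.WellFormed := by
  simp [main, treatPairs, addStars, starRound, addStar, findBest, countHits, treatPair, fillCut,
    component, growPass, countSafe, Cmd.WellFormed, Cmd.regs]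

theorem zero_notMem_regs_main : 0 ∉ main.regs := by decide

/-- The deepest nests have depth five: `growPass` inside `component` for every pair, and `countHits`
for every vertex in every star round. One factor `n` is to spare. -/
theorem depth_main : main.depth ≤ 6 := by decide

end Algorithm

/-! ### Sets represented by arrays -/

/-- The set of pairs whose bit is set in a matrix. -/
def pairSet (n : ℕ) (f : ℕ → ℕ) : Finset (Fin n × Fin n) :=
  {p | f ((p.1 : ℕ) * n + p.2) ≠ 0}

/-- The set of vertices whose bit is set in a vector. -/
def vertexSet (n : ℕ) (f : ℕ → ℕ) : Finset (Fin n) := {x | f x ≠ 0}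

@[simp]
theorem mem_pairSet {n : ℕ} {f : ℕ → ℕ} {x y : Fin n} :
    (x, y) ∈ pairSet n f ↔ f ((x : ℕ) * n + y) ≠ 0 := by
  simp [pairSet]

@[simp]
theorem mem_vertexSet {n : ℕ} {f : ℕ → ℕ} {x : Fin n} : x ∈ vertexSet n f ↔ f x ≠ 0 := by
  simp [vertexSet]

theorem index_inj {n : ℕ} {x y x' y' : Fin n} :
    (x : ℕ) * n + y = (x' : ℕ) * n + y' ↔ x = x' ∧ y = y' := by
  refine ⟨fun h => ?_, by rintro ⟨rfl, rfl⟩; rfl⟩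
  have hn : 0 < n := x.pos
  have h1 := congrArg (· / n) h
  have h2 := congrArg (· % n) h
  simp only [mul_comm _ n, Nat.mul_add_div hn, Nat.div_eq_of_lt (Fin.is_lt _), add_zero,
    Nat.mul_add_mod, Nat.mod_eq_of_lt (Fin.is_lt _)] at h1 h2
  exact ⟨Fin.ext h1, Fin.ext h2⟩

theorem setCell_arr {s : State} {a i k : ℕ} :
    (s.setCell a i k).arr a = Function.update (s.arr a) i k := by
  simp [State.setCell]

theorem mem_pairSet_update {n : ℕ} {f : ℕ → ℕ} {x y x' y' : Fin n} {k : ℕ} :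
    (x, y) ∈ pairSet n (Function.update f ((x' : ℕ) * n + y') k) ↔
      if x = x' ∧ y = y' then k ≠ 0 else (x, y) ∈ pairSet n f := by
  rw [mem_pairSet, mem_pairSet, Function.update_apply]
  simp only [index_inj]
  split_ifs <;> rfl

theorem mem_vertexSet_update {n : ℕ} {f : ℕ → ℕ} {x x' : Fin n} {k : ℕ} :
    x ∈ vertexSet n (Function.update f x' k) ↔ if x = x' then k ≠ 0 else x ∈ vertexSet n f := by
  rw [mem_vertexSet, mem_vertexSet, Function.update_apply]
  simp only [Fin.val_inj]
  split_ifs <;> rfl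

/-- The state holds the instance `I`. -/
structure Holds {n : ℕ} (I : Instance (Fin n)) (s : State) : Prop where
  reg_zero : s.reg 0 = n
  arr_zero : s.arr 0 = (initial I).arr 0

/-- The state holds the instance `I` and registers `1` and `2` hold the pair `(u, v)`. -/
structure HoldsAt {n : ℕ} (I : Instance (Fin n)) (u v : Fin n) (s : State) : Prop
    extends Holds I s where
  reg_one : s.reg 1 = u
  reg_two : s.reg 2 = v

/-! ### Reading the instance, and rules for sums and nested loops -/

section

variable {n : ℕ} {I : Instance (Fin n)} {u v : Fin n} {s s' : State}

theorem Holds.of_eq (h : Holds I s) (h0 : s'.reg 0 = s.reg 0) (ha : s'.arr 0 = s.arr 0) :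
    Holds I s' :=
  ⟨h0.trans h.1, ha.trans h.2⟩

theorem HoldsAt.of_eq (h : HoldsAt I u v s) (h0 : s'.reg 0 = s.reg 0) (h1 : s'.reg 1 = s.reg 1)
    (h2 : s'.reg 2 = s.reg 2) (ha : s'.arr 0 = s.arr 0) : HoldsAt I u v s' :=
  ⟨h.toHolds.of_eq h0 ha, h1.trans h.2, h2.trans h.3⟩

theorem initial_holds : Holds I (initial I) := ⟨by simp [initial], rfl⟩

open Algorithm

theorem HoldsAt.eval_inSafe (h : HoldsAt I u v s) {r : ℕ} {w : Fin n} (hw : s.reg r = w) :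
    (inSafe r).eval s ≠ 0 ↔ w ∈ I.safe u v := by
  -- The address is a number with base-`n` digits `u`, `v`, `w`, so it determines the triple.
  have key : (∃ u' v' w' : Fin n, ((u : ℕ) * n + v) * n + w = ((u' : ℕ) * n + v') * n + w' ∧
      w' ∈ I.safe u' v') ↔ w ∈ I.safe u v := by
    refine ⟨?_, fun hw => ⟨u, v, w, rfl, hw⟩⟩
    rintro ⟨u', v', w', e, hw'⟩
    have hn : 0 < n := u.pos
    have h1 := congrArg (· / n) e
    have h2 := congrArg (· % n) e
    simp only [mul_comm _ n, Nat.mul_add_div hn, Nat.div_eq_of_lt (Fin.is_lt _), add_zero,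
      Nat.mul_add_mod, Nat.mod_eq_of_lt (Fin.is_lt _)] at h1 h2
    rw [mul_comm n (u : ℕ), mul_comm n (u' : ℕ)] at h1
    obtain ⟨rfl, rfl⟩ := index_inj.1 h1
    rwa [Fin.ext h2]
  simp only [inSafe, pairIndex, Expr.eval, h.reg_zero, h.reg_one, h.reg_two, hw, h.arr_zero,
    initial, true_and]
  rw [← key]
  simp

/-- A loop that adds `F i` to register `r` in round `i` adds the sum of `F`. -/
theorem Cmd.den_each_sum {x r : ℕ} {p : Cmd} (F : Fin n → ℕ) (hx : x ∉ p.regs) (hr : r ≠ x)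
    (hn : s.reg 0 = n)
    (hstep : ∀ (i : Fin n) (s' : State), s'.reg x = i →
      (∀ r, r ∉ (each x p).regs → s'.reg r = s.reg r) →
      (∀ a, a ∉ (each x p).arrs → s'.arr a = s.arr a) →
      (p.den s').reg r = s'.reg r + F i) :
    ((each x p).den s).reg r = s.reg r + ∑ i, F i := by
  have key := Cmd.den_each (x := x) (p := p) (s := s) (n := n)
    (fun i s' => s'.reg r = s.reg r + ∑ w ∈ Finset.univ.filter fun w : Fin n => (w : ℕ) < i, F w) hx hn
    (fun _ _ _ h => by simpa [State.setReg, hr] using h) (by simp) ?_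
  · simpa using key
  · intro i hi s' h1 h2 h3 h4
    rw [hstep ⟨i, hi⟩ s' h1 h2 h3, h4]
    have e : (Finset.univ.filter fun w : Fin n => (w : ℕ) < i + 1) =
        insert ⟨i, hi⟩ (Finset.univ.filter fun w : Fin n => (w : ℕ) < i) := by
      ext w
      simp only [Finset.mem_filter, Finset.mem_univ, true_and, Finset.mem_insert, Fin.ext_iff]
      omega
    rw [e, Finset.sum_insert (by simp)]
    ring

/-- The invariant rule for two nested loops. -/
theorem Cmd.den_each_each {x y : ℕ} {p : Cmd} (Inv : ℕ → ℕ → State → Prop)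
    (hx : x ∉ (each y p).regs) (hy : y ∉ p.regs) (h0 : 0 ∉ (each x (each y p)).regs)
    (hn : s.reg 0 = n)
    (hsetx : ∀ i j s k, Inv i j s → Inv i j (s.setReg x k))
    (hsety : ∀ i j s k, Inv i j s → Inv i j (s.setReg y k))
    (hinit : Inv 0 0 s)
    (hcarry : ∀ i s', Inv i n s' → Inv (i + 1) 0 s')
    (hstep : ∀ (i j : Fin n) (s' : State), s'.reg x = i → s'.reg y = j →
      (∀ r, r ∉ (each x (each y p)).regs → s'.reg r = s.reg r) →
      (∀ a, a ∉ (each x (each y p)).arrs → s'.arr a = s.arr a) →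
      Inv i j s' → Inv i (j + 1) (p.den s')) :
    Inv n 0 ((each x (each y p)).den s) := by
  refine Cmd.den_each (fun i => Inv i 0) hx hn (fun i => hsetx i 0) hinit ?_
  intro i hi s₁ hs₁ hr₁ ha₁ h₁
  refine hcarry _ _ (Cmd.den_each (fun j => Inv i j) hy ((hr₁ 0 h0).trans hn) (hsety i) h₁ ?_)
  intro j hj s₂ hs₂ hr₂ ha₂ h₂
  refine hstep ⟨i, hi⟩ ⟨j, hj⟩ s₂ ((hr₂ x hx).trans hs₁) hs₂ (fun r hr => ?_) (fun a ha => ?_) h₂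
  · simp only [regs, List.mem_cons, not_or] at hr
    rw [hr₂ r (by simp [regs, hr]), hr₁ r (by simp [regs, hr])]
  · rw [ha₂ a ha, ha₁ a ha]

open Classical in
theorem countSafe_spec (h : HoldsAt I u v s) :
    (countSafe.den s).reg 3 = Finset.card {w | w ∈ I.safe u v} := by
  have key := Cmd.den_each_sum (x := 4) (r := 3) (p := .tally 3 (inSafe 4)) (s := s.setReg 3 0)
    (fun w => if w ∈ I.safe u v then 1 else 0) (by decide) (by decide) h.reg_zero ?_
  · rw [countSafe, Cmd.den, Cmd.den, key, Finset.card_filter]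
    simp [State.setReg]
  · intro w s' h4 hr ha
    have hs' : HoldsAt I u v s' := h.of_eq (hr 0 (by decide)) (hr 1 (by decide))
      (hr 2 (by decide)) (ha 0 (by decide))
    simp [Cmd.den, State.setReg, Nat.pos_iff_ne_zero, hs'.eval_inSafe h4]

/-! ### Components and cuts within a safe set -/

/-- The set `K` contains all its `D`-neighbours in `S`. -/
def ClosedWithin (D : Finset (Fin n × Fin n)) (S : Set (Fin n)) (K : Finset (Fin n)) : Prop :=
  ∀ x ∈ K, ∀ y ∈ S, (x, y) ∈ D ∨ (y, x) ∈ D → y ∈ K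

/-- The pass updates the array in place, so vertices added early may add further ones and the result
has no simple closed form. It is only sandwiched: it contains all neighbours of `T` in `S`, and lies
in every closed set containing `T`. -/
theorem growPass_spec (h : HoldsAt I u v s) :
    let D := pairSet n (s.arr 1)
    let S := I.safe u v
    let T := vertexSet n (s.arr 2)
    let T' := vertexSet n ((growPass.den s).arr 2)
    T ⊆ T' ∧ (∀ x ∈ T, ∀ y ∈ S, (x, y) ∈ D ∨ (y, x) ∈ D → y ∈ T') ∧
      ∀ K, ClosedWithin D S K → T ⊆ K → T' ⊆ K := by
  intro D S T T'
  let Good : ℕ → ℕ → State → Prop := fun i j s' =>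
    let T' := vertexSet n (s'.arr 2)
    T ⊆ T' ∧ (∀ x ∈ T, ∀ y ∈ S, (x : ℕ) < i ∨ (x : ℕ) = i ∧ (y : ℕ) < j →
      (x, y) ∈ D ∨ (y, x) ∈ D → y ∈ T') ∧ ∀ K, ClosedWithin D S K → T ⊆ K → T' ⊆ K
  suffices Good n 0 (growPass.den s) from
    ⟨this.1, fun x hx y hy => this.2.1 x hx y hy (.inl x.2), this.2.2⟩
  refine Cmd.den_each_each Good (by decide) (by decide) (by decide) h.reg_zero
    (fun _ _ _ _ hi => hi) (fun _ _ _ _ hi => hi) ⟨subset_rfl, by simp, fun _ _ hK => hK⟩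
    (fun i s' hi => ⟨hi.1, fun x hx y hy hxi => hi.2.1 x hx y hy (by omega), hi.2.2⟩) ?_
  intro x y s₂ e6 e7 hr ha good
  have h₂ : HoldsAt I u v s₂ := h.of_eq (hr 0 (by decide)) (hr 1 (by decide)) (hr 2 (by decide))
    (ha 0 (by decide))
  have e1 : s₂.arr 1 = s.arr 1 := ha 1 (by decide)
  have cond : (Expr.times (.cell 2 (.reg 6)) (.times (inSafe 7)
      (.plus (.cell 1 (pairIndex 6 7)) (.cell 1 (pairIndex 7 6))))).eval s₂ ≠ 0 ↔
      x ∈ vertexSet n (s₂.arr 2) ∧ y ∈ S ∧ ((x, y) ∈ D ∨ (y, x) ∈ D) := by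
    simp only [Expr.eval, mul_ne_zero_iff, h₂.eval_inSafe e7, pairIndex, h₂.reg_zero, e6, e7, e1,
      mem_vertexSet, D, S, mem_pairSet]
    refine and_congr_right fun _ => and_congr_right fun _ => ?_
    omega
  rw [Cmd.den]
  by_cases hc : x ∈ vertexSet n (s₂.arr 2) ∧ y ∈ S ∧ ((x, y) ∈ D ∨ (y, x) ∈ D)
  · rw [if_pos (cond.2 hc)]
    have mem : ∀ z, z ∈ vertexSet n (((Cmd.mark 2 (.reg 7) (.lit 1)).den s₂).arr 2) ↔
        z = y ∨ z ∈ vertexSet n (s₂.arr 2) := by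
      intro z
      rw [Cmd.den, setCell_arr]
      simp only [Expr.eval, e7, mem_vertexSet_update]
      by_cases hz : z = y <;> simp [hz]
    refine ⟨fun z hz => (mem z).2 (.inr (good.1 hz)), fun a ha b hb hab hD => ?_,
      fun K hK hT z hz => ?_⟩
    · rw [mem]
      by_cases hby : b = y
      · exact .inl hby
      · refine .inr (good.2.1 a ha b hb ?_ hD)
        have : (b : ℕ) ≠ y := fun e => hby (Fin.ext e)
        omega
    · rcases (mem z).1 hz with rfl | hz
      · exact hK x (good.2.2 K hK hT hc.1) _ hc.2.1 hc.2.2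
      · exact good.2.2 K hK hT hz
  · rw [if_neg (cond.not.2 hc)]
    refine ⟨good.1, fun a ha b hb hab hD => ?_, good.2.2⟩
    by_cases hx : a = x ∧ b = y
    · obtain ⟨rfl, rfl⟩ := hx
      exact absurd ⟨good.1 ha, hb, hD⟩ hc
    · refine good.2.1 a ha b hb ?_ hD
      rw [Fin.ext_iff, Fin.ext_iff] at hx
      omega

theorem Cmd.den_seq (p q : Cmd) : (Cmd.seq p q).den s = q.den (p.den s) := rfl

theorem component_spec (h : HoldsAt I u v s) :
    let D := pairSet n (s.arr 1)
    let S := I.safe u v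
    let T := vertexSet n ((component.den s).arr 2)
    u ∈ T ∧ ClosedWithin D S T ∧ ∀ K, ClosedWithin D S K → u ∈ K → T ⊆ K := by
  intro D S T
  have init := Cmd.den_each (x := 6) (p := .mark 2 (.reg 6) (.equal (.reg 6) (.reg 1))) (s := s)
    (n := n) (fun i s' => ∀ z : Fin n, (z : ℕ) < i → (z ∈ vertexSet n (s'.arr 2) ↔ z = u))
    (by decide) h.reg_zero (fun _ _ _ hi => hi) (by simp) (by
      intro i hi s' e6 hr ha hinv z hz
      have e1 : s'.reg 1 = u := (hr 1 (by decide)).trans h.reg_one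
      generalize hx : (⟨i, hi⟩ : Fin n) = x
      obtain rfl : i = x := congrArg Fin.val hx
      rw [Cmd.den, setCell_arr]
      simp only [Expr.eval, e6, e1, mem_vertexSet_update, Fin.val_inj]
      by_cases h1 : z = x
      · subst h1
        simp
      · rw [if_neg h1]
        refine hinv z ?_
        rw [Fin.ext_iff] at h1
        omega)
  rw [show T = vertexSet n (((Cmd.each 5 growPass).den ((Cmd.each 6 (.mark 2 (.reg 6)
    (.equal (.reg 6) (.reg 1)))).den s)).arr 2) from rfl]
  generalize hs₁ : (Cmd.each 6 (.mark 2 (.reg 6) (.equal (.reg 6) (.reg 1)))).den s = s₁ at init ⊢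
  have h₁ : HoldsAt I u v s₁ := by
    subst hs₁
    exact h.of_eq (Cmd.den_reg _ (by decide)) (Cmd.den_reg _ (by decide))
      (Cmd.den_reg _ (by decide)) (Cmd.den_arr _ (by decide))
  have hD : pairSet n (s₁.arr 1) = D := by
    subst hs₁
    rw [Cmd.den_arr _ (by decide)]
  have hT₁ : vertexSet n (s₁.arr 2) = {u} := by
    ext z
    rw [init z z.2, Finset.mem_singleton]
  -- While the set is not closed, every pass adds a vertex. After `n` passes the second alternative
  -- would require `n + 1` vertices.
  have loop := Cmd.den_each (x := 5) (p := growPass) (s := s₁) (n := n)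
    (fun p s' =>
      let T := vertexSet n (s'.arr 2)
      (ClosedWithin D S T ∨ p + 1 ≤ T.card) ∧ u ∈ T ∧ ∀ K, ClosedWithin D S K → u ∈ K → T ⊆ K)
    (by decide) h₁.reg_zero (fun _ _ _ hi => hi)
    (by simp [hT₁]) (by
      rintro i hi s₂ - hr ha ⟨hcl, hu, hmin⟩
      have h₂ : HoldsAt I u v s₂ := h₁.of_eq (hr 0 (by decide)) (hr 1 (by decide))
        (hr 2 (by decide)) (ha 0 (by decide))
      obtain ⟨g1, g2, g3⟩ := growPass_spec h₂
      rw [ha 1 (by decide), hD] at g2 g3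
      refine ⟨?_, g1 hu, fun K hK huK => g3 K hK (hmin K hK huK)⟩
      by_cases hc : ClosedWithin D S (vertexSet n (s₂.arr 2))
      · rw [Finset.Subset.antisymm (g3 _ hc subset_rfl) g1]
        exact .inl hc
      · right
        have hcard := hcl.resolve_left hc
        simp only [ClosedWithin, not_forall] at hc
        obtain ⟨x, hx, y, hy, hxy, hyT⟩ := hc
        have := Finset.card_lt_card (Finset.ssubset_iff_of_subset g1 |>.2
          ⟨y, g2 x hx y hy hxy, hyT⟩)
        omega)
  refine ⟨loop.2.1, loop.1.resolve_right fun hcard => ?_, loop.2.2⟩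
  have := Finset.card_le_univ (vertexSet n (((Cmd.each 5 growPass).den s₁).arr 2))
  rw [Fintype.card_fin] at this
  omega

theorem fillCut_spec (h : HoldsAt I u v s) (x y : Fin n) :
    let T := vertexSet n (s.arr 2)
    (x, y) ∈ pairSet n ((fillCut.den s).arr 1) ↔
      (x, y) ∈ pairSet n (s.arr 1) ∨ (x ∈ T ∧ y ∈ I.safe u v ∧ y ∉ T) := by
  intro T
  let Inv : ℕ → ℕ → State → Prop := fun i j s' => ∀ x y : Fin n,
    (x, y) ∈ pairSet n (s'.arr 1) ↔ (x, y) ∈ pairSet n (s.arr 1) ∨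
      (((x : ℕ) < i ∨ (x : ℕ) = i ∧ (y : ℕ) < j) ∧ x ∈ T ∧ y ∈ I.safe u v ∧ y ∉ T)
  suffices Inv n 0 (fillCut.den s) by
    simpa using this x y
  refine Cmd.den_each_each Inv (by decide) (by decide) (by decide) h.reg_zero
    (fun _ _ _ _ hi => hi) (fun _ _ _ _ hi => hi) (by simp [Inv]) ?_ ?_
  · intro i s' hi x y
    rw [hi x y]
    have := y.2
    refine or_congr_right (and_congr_left fun _ => ?_)
    omega
  intro x y s₂ e6 e7 hr ha hinv
  have h₂ : HoldsAt I u v s₂ := h.of_eq (hr 0 (by decide)) (hr 1 (by decide)) (hr 2 (by decide))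
    (ha 0 (by decide))
  have e2 : s₂.arr 2 = s.arr 2 := ha 2 (by decide)
  have cond : (Expr.times (.cell 2 (.reg 6)) (.times (inSafe 7)
      (.equal (.cell 2 (.reg 7)) (.lit 0)))).eval s₂ ≠ 0 ↔ x ∈ T ∧ y ∈ I.safe u v ∧ y ∉ T := by
    simp only [Expr.eval, mul_ne_zero_iff, h₂.eval_inSafe e7, e6, e7, e2, T, mem_vertexSet]
    simp
  have hlt : ∀ a b : Fin n, ((a : ℕ) < x ∨ (a : ℕ) = x ∧ (b : ℕ) < y + 1) ↔
      ((a : ℕ) < x ∨ (a : ℕ) = x ∧ (b : ℕ) < y) ∨ (a = x ∧ b = y) := by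
    intro a b
    rw [Fin.ext_iff, Fin.ext_iff]
    omega
  intro a b
  rw [Cmd.den, hlt]
  by_cases hc : x ∈ T ∧ y ∈ I.safe u v ∧ y ∉ T
  · rw [if_pos (cond.2 hc), Cmd.den, setCell_arr]
    simp only [Expr.eval, pairIndex, e6, e7, h₂.reg_zero, mem_pairSet_update]
    by_cases hab : a = x ∧ b = y
    · obtain ⟨rfl, rfl⟩ := hab
      simp [hc]
    · simp only [hab, if_false, or_false]
      exact hinv a b
  · rw [if_neg (cond.not.2 hc), hinv a b]
    by_cases hab : a = x ∧ b = y
    · obtain ⟨rfl, rfl⟩ := hab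
      simp [hc]
    · simp only [hab, or_false]

open Classical in
/-- The safe set of `(u, v)` has more than `n ^ (1 / 3)` elements. -/
def Thick (I : Instance (Fin n)) (u v : Fin n) : Prop :=
  n < Finset.card {w | w ∈ I.safe u v} ^ 3

/-- The component `T` appears as the least closed set containing `u`. Closedness shows that the
edges of the cut are new; minimality shows that the vertices of `T` are reachable from `u`. -/
theorem treatPair_spec (h : HoldsAt I u v s) :
    let D := pairSet n (s.arr 1)
    let S := I.safe u v
    (∀ x y, (x, y) ∈ pairSet n ((treatPair.den s).arr 3) ↔
      if x = u ∧ y = v then Thick I u v else (x, y) ∈ pairSet n (s.arr 3)) ∧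
    ∃ T : Finset (Fin n), u ∈ T ∧ ClosedWithin D S T ∧
      (∀ K, ClosedWithin D S K → u ∈ K → T ⊆ K) ∧
      ∀ x y, (x, y) ∈ pairSet n ((treatPair.den s).arr 1) ↔
        (x, y) ∈ D ∨ ((¬ Thick I u v ∧ v ∉ T) ∧ x ∈ T ∧ y ∈ S ∧ y ∉ T) := by
  intro D S
  have h3 := countSafe_spec h
  have r0 := Cmd.den_reg countSafe (s := s) (r := 0) (by decide)
  have r1 := Cmd.den_reg countSafe (s := s) (r := 1) (by decide)
  have r2 := Cmd.den_reg countSafe (s := s) (r := 2) (by decide)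
  have ha := fun a => Cmd.den_arr countSafe (s := s) (a := a) (by simp [countSafe, Cmd.arrs])
  rw [treatPair, Cmd.den_seq, Cmd.den_seq, Cmd.den_seq]
  generalize countSafe.den s = s₁ at h3 r0 r1 r2 ha ⊢
  have h₁ : HoldsAt I u v s₁ := h.of_eq r0 r1 r2 (ha 0)
  have thick : ∀ s', s'.reg 0 = s₁.reg 0 → s'.reg 3 = s₁.reg 3 →
      (isThick.eval s' ≠ 0 ↔ Thick I u v) := by
    intro s' e0 e3
    rw [Thick, ← h3]
    simp only [isThick, Expr.eval, e0, e3, h₁.reg_zero]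
    rw [pow_three]
    split_ifs <;> simp_all
  have hs₂ : ((Cmd.mark 3 (pairIndex 1 2) isThick).den s₁).arr 3 =
      Function.update (s₁.arr 3) (u * n + v) (if 0 < isThick.eval s₁ then 1 else 0) := by
    rw [Cmd.den, setCell_arr, pairIndex]
    simp [Expr.eval, h₁.reg_zero, h₁.reg_one, h₁.reg_two]
  have r' := fun r => Cmd.den_reg (Cmd.mark 3 (pairIndex 1 2) isThick) (s := s₁) (r := r)
    (by simp [Cmd.regs])
  have a' := fun a (ha : a ≠ 3) => Cmd.den_arr (Cmd.mark 3 (pairIndex 1 2) isThick) (s := s₁)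
    (a := a) (by simpa [Cmd.arrs] using ha)
  generalize (Cmd.mark 3 (pairIndex 1 2) isThick).den s₁ = s₂ at hs₂ r' a' ⊢
  have h₂ : HoldsAt I u v s₂ := h₁.of_eq (r' 0) (r' 1) (r' 2) (a' 0 (by decide))
  obtain ⟨huT, hcl, hmin⟩ := component_spec h₂
  have q0 := Cmd.den_reg component (s := s₂) (r := 0) (by decide)
  have q1 := Cmd.den_reg component (s := s₂) (r := 1) (by decide)
  have q2 := Cmd.den_reg component (s := s₂) (r := 2) (by decide)
  have q3 := Cmd.den_reg component (s := s₂) (r := 3) (by decide)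
  have qa := fun a (ha : a ≠ 2) => Cmd.den_arr component (s := s₂) (a := a)
    (by simpa [component, growPass, Cmd.arrs] using ha)
  generalize component.den s₂ = s₃ at huT hcl hmin q0 q1 q2 q3 qa ⊢
  have h₃ : HoldsAt I u v s₃ := h₂.of_eq q0 q1 q2 (qa 0 (by decide))
  have hD₂ : pairSet n (s₂.arr 1) = D := by rw [a' 1 (by decide), ha 1]
  have hD₃ : pairSet n (s₃.arr 1) = D := by rw [qa 1 (by decide), hD₂]
  rw [hD₂] at hcl hmin
  constructor
  · intro x y
    have e : (Cmd.den (.cond (.times (.equal isThick (.lit 0))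
        (.equal (.cell 2 (.reg 2)) (.lit 0))) fillCut) s₃).arr 3 = s₂.arr 3 :=
      (Cmd.den_arr _ (by decide)).trans (qa 3 (by decide))
    rw [e, hs₂, mem_pairSet_update, ha 3]
    have := thick s₁ rfl rfl
    split_ifs <;> simp_all [Nat.pos_iff_ne_zero]
  · refine ⟨_, huT, hcl, hmin, fun x y => ?_⟩
    have cond : (Expr.times (.equal isThick (.lit 0))
        (.equal (.cell 2 (.reg 2)) (.lit 0))).eval s₃ ≠ 0 ↔
        ¬ Thick I u v ∧ v ∉ vertexSet n (s₃.arr 2) := by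
      rw [← thick s₃ (q0.trans (r' 0)) (q3.trans (r' 3))]
      simp only [Expr.eval, h₃.reg_two, mem_vertexSet]
      split_ifs <;> simp_all
    rw [Cmd.den]
    by_cases hc : ¬ Thick I u v ∧ v ∉ vertexSet n (s₃.arr 2)
    · rw [if_pos (cond.2 hc)]
      refine (fillCut_spec h₃ x y).trans ?_
      rw [hD₃]
      simp only [hc, not_false_eq_true, true_and, S]
    · rw [if_neg (cond.not.2 hc), hD₃]
      simp only [hc, false_and, or_false]

/-! ### Thin pairs: charging the added cuts to a feasible solution -/

/-- The graph whose edges are the pairs in `D`, in either order. -/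
def graphOf (D : Finset (Fin n × Fin n)) : SimpleGraph (Fin n) :=
  SimpleGraph.fromRel fun x y => (x, y) ∈ D

theorem graphOf_adj {D : Finset (Fin n × Fin n)} {x y : Fin n} :
    (graphOf D).Adj x y ↔ x ≠ y ∧ ((x, y) ∈ D ∨ (y, x) ∈ D) :=
  SimpleGraph.fromRel_adj _ _ _

theorem graphOf_mono {D D' : Finset (Fin n × Fin n)} (h : D ⊆ D') : graphOf D ≤ graphOf D' := by
  intro x y
  rw [graphOf_adj, graphOf_adj]
  exact fun hxy => ⟨hxy.1, hxy.2.imp (@h _) (@h _)⟩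

theorem output_eq : output n s = graphOf (pairSet n (s.arr 1)) := by
  simp [output, graphOf]

theorem ncard_edgeSet_graphOf_le (D : Finset (Fin n × Fin n)) :
    (graphOf D).edgeSet.ncard ≤ D.card := by
  classical
  rw [← Set.ncard_coe_finset D]
  refine (Set.ncard_le_ncard (t := (fun p : Fin n × Fin n => s(p.1, p.2)) '' D) ?_
    (Set.toFinite _)).trans (Set.ncard_image_le (Set.toFinite _))
  intro e
  induction e with
  | _ x y =>
    rw [SimpleGraph.mem_edgeSet, graphOf_adj]
    rintro ⟨-, h | h⟩
    · exact ⟨_, h, rfl⟩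
    · exact ⟨_, h, Sym2.eq_swap⟩

/-- There is a walk in `G` from `u` to `v` all of whose vertices lie in `S`. -/
def ConnectedWithin (G : SimpleGraph (Fin n)) (S : Set (Fin n)) (u v : Fin n) : Prop :=
  ∃ p : G.Walk u v, ∀ w ∈ p.support, w ∈ S

theorem ConnectedWithin.mono {G G' : SimpleGraph (Fin n)} {S : Set (Fin n)}
    (h : ConnectedWithin G S u v) (hG : G ≤ G') : ConnectedWithin G' S u v := by
  obtain ⟨p, hp⟩ := h
  exact ⟨p.mapLe hG, by simpa using hp⟩

theorem ConnectedWithin.exists_isPath {G : SimpleGraph (Fin n)} {S : Set (Fin n)}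
    (h : ConnectedWithin G S u v) : ∃ p : G.Walk u v, p.IsPath ∧ ∀ w ∈ p.support, w ∈ S := by
  classical
  obtain ⟨p, hp⟩ := h
  exact ⟨p.bypass, p.bypass_isPath, fun w hw => hp w (p.support_bypass_subset_support hw)⟩

theorem connectedWithin_self {G : SimpleGraph (Fin n)} {S : Set (Fin n)} (hu : u ∈ S) :
    ConnectedWithin G S u u :=
  ⟨.nil, by simpa using hu⟩

theorem ConnectedWithin.step {D : Finset (Fin n × Fin n)} {S : Set (Fin n)} {w : Fin n}
    (h : ConnectedWithin (graphOf D) S u v) (hw : w ∈ S) (hvw : (v, w) ∈ D ∨ (w, v) ∈ D) :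
    ConnectedWithin (graphOf D) S u w := by
  by_cases e : v = w
  · exact e ▸ h
  · obtain ⟨p, hp⟩ := h
    refine ⟨p.concat (graphOf_adj.2 ⟨e, hvw⟩), fun z hz => ?_⟩
    rw [SimpleGraph.Walk.support_concat, List.mem_append,
      List.mem_singleton] at hz
    rcases hz with hz | rfl
    · exact hp z hz
    · exact hw

-- With the minimality of `T`, this shows that every vertex of `T` is reachable from `u` within `S`.
open Classical in
theorem closedWithin_connectedWithin (D : Finset (Fin n × Fin n)) (S : Set (Fin n)) (u : Fin n) :
    ClosedWithin D S {z | ConnectedWithin (graphOf D) S u z} := by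
  intro x hx y hy hxy
  simp only [Finset.mem_filter, Finset.mem_univ, true_and] at hx ⊢
  exact hx.step hy hxy

theorem ConnectedWithin.mem {G : SimpleGraph (Fin n)} {S : Set (Fin n)}
    (h : ConnectedWithin G S u v) : v ∈ S := by
  obtain ⟨p, hp⟩ := h
  exact hp v p.end_mem_support

/-- `D` consists of at most `n ^ (2 / 3)` pairs for each edge that it shares with any given
feasible solution. -/
def Economical (I : Instance (Fin n)) (D : Finset (Fin n × Fin n)) : Prop :=
  ∀ G, SafelyConnected I G →
    (D.card : ℝ) ≤ (n : ℝ) ^ (2 / 3 : ℝ) * ((G ⊓ graphOf D).edgeSet.ncard : ℝ)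

theorem sq_le_rpow_of_cube_le {c n : ℕ} (h : c ^ 3 ≤ n) :
    (c : ℝ) ^ 2 ≤ (n : ℝ) ^ (2 / 3 : ℝ) := by
  have h1 : (c : ℝ) ^ 3 ≤ n := by exact_mod_cast h
  calc (c : ℝ) ^ 2 = ((c : ℝ) ^ 3) ^ (2 / 3 : ℝ) := by
        rw [← Real.rpow_natCast, ← Real.rpow_natCast, ← Real.rpow_mul (by positivity)]
        norm_num
    _ ≤ _ := Real.rpow_le_rpow (by positivity) h1 (by norm_num)

/-- The path of `G` from `u` to `v` inside the safe set leaves `T` along an edge of the added cut.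
That edge was not in `D`, as `T` is closed, so the intersection with `G` grows by at least one edge
while the number of pairs grows by at most `n ^ (2/3)`. -/
theorem Economical.fillCut {D D' : Finset (Fin n × Fin n)} {T : Finset (Fin n)}
    (hD : Economical I D) (hu : u ∈ T) (hv : v ∉ T) (hthin : ¬ Thick I u v)
    (hT : ClosedWithin D (I.safe u v) T) (hTS : ∀ x ∈ T, x ∈ I.safe u v)
    (hD' : ∀ x y, (x, y) ∈ D' ↔ (x, y) ∈ D ∨ (x ∈ T ∧ y ∈ I.safe u v ∧ y ∉ T)) :
    Economical I D' := by
  classical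
  intro G hG
  obtain ⟨p, -, hp⟩ := hG.2 u v
  obtain ⟨d, hd, hd1, hd2⟩ := p.exists_boundary_dart T hu hv
  have hsub : D ⊆ D' := fun ⟨x, y⟩ h => (hD' x y).2 (.inl h)
  have hdS : d.snd ∈ I.safe u v := hp _ (p.dart_snd_mem_support_of_mem_darts hd)
  have hlt : (G ⊓ graphOf D).edgeSet.ncard < (G ⊓ graphOf D').edgeSet.ncard := by
    refine Set.ncard_lt_ncard ⟨SimpleGraph.edgeSet_mono (inf_le_inf_left G (graphOf_mono hsub)),
      fun hle => ?_⟩ (Set.toFinite _)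
    have h1 : s(d.fst, d.snd) ∈ (G ⊓ graphOf D').edgeSet := by
      rw [SimpleGraph.mem_edgeSet]
      exact ⟨d.adj, graphOf_adj.2 ⟨d.adj.ne, .inl ((hD' _ _).2 (.inr ⟨hd1, hdS, hd2⟩))⟩⟩
    have h2 := hle h1
    rw [SimpleGraph.mem_edgeSet] at h2
    exact hd2 (hT _ hd1 _ hdS (graphOf_adj.1 h2.2).2)
  have hcard : D'.card ≤ D.card + Finset.card {w | w ∈ I.safe u v} ^ 2 := by
    rw [sq, ← Finset.card_product]
    refine (Finset.card_le_card ?_).trans (Finset.card_union_le _ _)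
    rintro ⟨x, y⟩ hxy
    rcases (hD' x y).1 hxy with h | h
    · exact Finset.mem_union_left _ h
    · exact Finset.mem_union_right _ (by simpa using ⟨hTS x h.1, h.2.1⟩)
  have hsq := sq_le_rpow_of_cube_le (not_lt.1 hthin)
  have h1 : (D'.card : ℝ) ≤ D.card + (Finset.card {w | w ∈ I.safe u v} : ℝ) ^ 2 := by
    exact_mod_cast hcard
  have h2 : ((G ⊓ graphOf D).edgeSet.ncard : ℝ) + 1 ≤ (G ⊓ graphOf D').edgeSet.ncard := by
    exact_mod_cast hlt
  have h3 := mul_le_mul_of_nonneg_left h2 (by positivity : 0 ≤ (n : ℝ) ^ (2 / 3 : ℝ))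
  linarith [hD G hG]

theorem treatPairs_spec (h : Holds I s) (h1 : pairSet n (s.arr 1) = ∅) :
    let D := pairSet n ((treatPairs.den s).arr 1)
    (∀ u v, (u, v) ∈ pairSet n ((treatPairs.den s).arr 3) ↔ Thick I u v) ∧
      (∀ u v, ¬ Thick I u v → ConnectedWithin (graphOf D) (I.safe u v) u v) ∧
      Economical I D := by
  intro D
  let Inv : ℕ → ℕ → State → Prop := fun i j s' =>
    let D := pairSet n (s'.arr 1)
    (∀ u v : Fin n, ((u : ℕ) < i ∨ (u : ℕ) = i ∧ (v : ℕ) < j) →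
      ((u, v) ∈ pairSet n (s'.arr 3) ↔ Thick I u v) ∧
      (¬ Thick I u v → ConnectedWithin (graphOf D) (I.safe u v) u v)) ∧ Economical I D
  suffices Inv n 0 (treatPairs.den s) from
    ⟨fun u v => (this.1 u v (.inl u.2)).1, fun u v => (this.1 u v (.inl u.2)).2, this.2⟩
  refine Cmd.den_each_each Inv (by decide) (by decide) (by decide) h.reg_zero
    (fun _ _ _ _ hi => hi) (fun _ _ _ _ hi => hi) ⟨by simp, ?_⟩ ?_ ?_
  · intro G _
    rw [h1, Finset.card_empty, Nat.cast_zero]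
    positivity
  · refine fun i s' hi => ⟨fun u v huv => hi.1 u v ?_, hi.2⟩
    have := v.2
    omega
  intro u v s₁ e1 e2 hr ha hinv
  have h₁ : HoldsAt I u v s₁ := ⟨h.of_eq (hr 0 (by decide)) (ha 0 (by decide)), e1, e2⟩
  obtain ⟨hN, T, huT, hcl, hmin, hD⟩ := treatPair_spec h₁
  have hsub : pairSet n (s₁.arr 1) ⊆ pairSet n ((treatPair.den s₁).arr 1) :=
    fun ⟨x, y⟩ hxy => (hD x y).2 (.inl hxy)
  have hTconn : ∀ x ∈ T, ConnectedWithin (graphOf (pairSet n (s₁.arr 1))) (I.safe u v) u x := by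
    classical
    intro x hx
    simpa using hmin _ (closedWithin_connectedWithin _ _ u)
      (by simpa using connectedWithin_self (I.left_mem u v)) hx
  constructor
  · intro a b hab
    by_cases huv : a = u ∧ b = v
    · obtain ⟨rfl, rfl⟩ := huv
      refine ⟨by simp [hN], fun hthin => ?_⟩
      by_cases hv : b ∈ T
      · exact (hTconn b hv).mono (graphOf_mono hsub)
      -- The added cut contains the pair `(a, b)` itself.
      · exact (connectedWithin_self (I.left_mem a b)).step (I.right_mem a b)
          (.inl ((hD a b).2 (.inr ⟨⟨hthin, hv⟩, huT, I.right_mem a b, hv⟩)))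
    · have hab' : (a : ℕ) < u ∨ (a : ℕ) = u ∧ (b : ℕ) < v := by
        rw [Fin.ext_iff, Fin.ext_iff] at huv
        omega
      rw [hN, if_neg huv]
      exact ⟨(hinv.1 a b hab').1, fun ht => ((hinv.1 a b hab').2 ht).mono (graphOf_mono hsub)⟩
  · by_cases hc : ¬ Thick I u v ∧ v ∉ T
    · exact hinv.2.fillCut huT hc.2 hc.1 hcl (fun x hx => (hTconn x hx).mem)
        (by simpa [hc] using hD)
    · have : pairSet n ((treatPair.den s₁).arr 1) = pairSet n (s₁.arr 1) := by
        ext ⟨x, y⟩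
        rw [hD x y]
        simp [hc]
      rw [this]
      exact hinv.2

/-! ### Thick pairs: greedy choice of stars -/

open Classical in
/-- The number of pairs in `N` whose safe set contains `w`. -/
noncomputable def hits (I : Instance (Fin n)) (N : Finset (Fin n × Fin n)) (w : Fin n) : ℕ :=
  Finset.card {p ∈ N | w ∈ I.safe p.1 p.2}

theorem countHits_spec (h : Holds I s) {w : Fin n} (hw : s.reg 4 = w) :
    (countHits.den s).reg 3 = hits I (pairSet n (s.arr 3)) w := by
  classical
  let F : Fin n → Fin n → ℕ := fun u v =>
    if (u, v) ∈ pairSet n (s.arr 3) ∧ w ∈ I.safe u v then 1 else 0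
  have key := Cmd.den_each_sum (x := 1) (r := 3)
    (p := .each 2 (.tally 3 (.times (.cell 3 (pairIndex 1 2)) (inSafe 4)))) (s := s.setReg 3 0)
    (fun u => ∑ v, F u v) (by decide) (by decide) h.reg_zero ?_
  · rw [countHits, Cmd.den_seq, Cmd.den, key, hits, ← Fintype.sum_prod_type']
    simp only [F, ← Finset.card_filter]
    simp only [State.setReg, Function.update_self, zero_add]
    congr 1
    ext p
    simp
  · intro u s₁ e1 hr₁ ha₁
    refine Cmd.den_each_sum _ (by decide) (by decide) ((hr₁ 0 (by decide)).trans h.reg_zero) ?_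
    intro v s₂ e2 hr₂ ha₂
    have h₂ : HoldsAt I u v s₂ := ⟨h.of_eq ((hr₂ 0 (by decide)).trans (hr₁ 0 (by decide)))
      ((ha₂ 0 (by decide)).trans (ha₁ 0 (by decide))), (hr₂ 1 (by decide)).trans e1, e2⟩
    have e4 : s₂.reg 4 = w := ((hr₂ 4 (by decide)).trans (hr₁ 4 (by decide))).trans hw
    have e3 : s₂.arr 3 = s.arr 3 := (ha₂ 3 (by decide)).trans (ha₁ 3 (by decide))
    have cond : (Expr.times (.cell 3 (pairIndex 1 2)) (inSafe 4)).eval s₂ ≠ 0 ↔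
        (u, v) ∈ pairSet n (s.arr 3) ∧ w ∈ I.safe u v := by
      simp only [Expr.eval, mul_ne_zero_iff, h₂.eval_inSafe e4, pairIndex, h₂.reg_zero,
        h₂.reg_one, h₂.reg_two, e3, mem_pairSet]
    simp [Cmd.den, State.setReg, Nat.pos_iff_ne_zero, cond, F]

theorem findBest_spec (h : Holds I s) :
    let N := pairSet n (s.arr 3)
    let b := (findBest.den s).reg 8
    (∀ w, hits I N w ≤ b) ∧ (b ≠ 0 → ∃ w : Fin n, (findBest.den s).reg 9 = w ∧ b ≤ hits I N w) := by
  intro N b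
  let Inv : ℕ → State → Prop := fun i s' =>
    (∀ w : Fin n, (w : ℕ) < i → hits I N w ≤ s'.reg 8) ∧
      (s'.reg 8 ≠ 0 → ∃ w : Fin n, s'.reg 9 = w ∧ s'.reg 8 ≤ hits I N w)
  suffices Inv n (findBest.den s) from ⟨fun w => this.1 w w.2, this.2⟩
  rw [findBest, Cmd.den_seq, Cmd.den_seq]
  have h₀ : Holds I ((Cmd.clear 9).den ((Cmd.clear 8).den s)) := h.of_eq rfl rfl
  refine Cmd.den_each Inv (by decide) h₀.reg_zero (fun _ _ _ hi => hi)
    ⟨by simp, fun h8 => absurd rfl h8⟩ ?_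
  intro i hi s₁ e4 hr ha hinv
  have h₁ : Holds I s₁ := h₀.of_eq (hr 0 (by decide)) (ha 0 (by decide))
  generalize hx : (⟨i, hi⟩ : Fin n) = x
  obtain rfl : i = x := congrArg Fin.val hx
  have e3 := countHits_spec h₁ e4
  rw [ha 3 (by decide), show ((Cmd.clear 9).den ((Cmd.clear 8).den s)).arr 3 = s.arr 3 from rfl]
    at e3
  have r8 := Cmd.den_reg countHits (s := s₁) (r := 8) (by decide)
  have r9 := Cmd.den_reg countHits (s := s₁) (r := 9) (by decide)
  have r4 := Cmd.den_reg countHits (s := s₁) (r := 4) (by decide)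
  rw [Cmd.den_seq]
  generalize countHits.den s₁ = s₂ at e3 r8 r9 r4 ⊢
  rw [Cmd.den]
  have hlt : ∀ w : Fin n, (w : ℕ) < x + 1 → (w : ℕ) < x ∨ w = x := by
    intro w hw
    rw [Fin.ext_iff]
    omega
  simp only [Expr.eval, e3, r8]
  by_cases hc : s₁.reg 8 < hits I N x
  · have g8 : ((Cmd.seq (.copy 8 3) (.copy 9 4)).den s₂).reg 8 = hits I N x := e3
    have g9 : ((Cmd.seq (.copy 8 3) (.copy 9 4)).den s₂).reg 9 = x := r4.trans e4
    rw [if_pos (by simpa [N] using hc)]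
    refine ⟨fun w hw => ?_, fun _ => ⟨x, g9, g8.le⟩⟩
    rw [g8]
    rcases hlt w hw with hw | rfl
    · exact (hinv.1 w hw).trans hc.le
    · exact le_rfl
  · rw [if_neg (by simpa [N] using hc)]
    refine ⟨fun w hw => ?_, by rw [r8, r9]; exact hinv.2⟩
    rw [r8]
    rcases hlt w hw with hw | rfl
    · exact hinv.1 w hw
    · exact not_lt.1 hc

theorem addStar_spec (h : Holds I s) {w : Fin n} (hw : s.reg 9 = w) (x y : Fin n) :
    ((x, y) ∈ pairSet n ((addStar.den s).arr 1) ↔ (x, y) ∈ pairSet n (s.arr 1) ∨ x = w) ∧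
    ((x, y) ∈ pairSet n ((addStar.den s).arr 3) ↔
      (x, y) ∈ pairSet n (s.arr 3) ∧ w ∉ I.safe x y) := by
  have star : ∀ x y : Fin n, (x, y) ∈ pairSet n
      (((Cmd.each 6 (.mark 1 (pairIndex 9 6) (.lit 1))).den s).arr 1) ↔
      (x, y) ∈ pairSet n (s.arr 1) ∨ (x = w ∧ (y : ℕ) < n) := by
    refine Cmd.den_each (fun i s' => ∀ x y : Fin n, (x, y) ∈ pairSet n (s'.arr 1) ↔
      (x, y) ∈ pairSet n (s.arr 1) ∨ (x = w ∧ (y : ℕ) < i)) (by decide) h.reg_zero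
      (fun _ _ _ hi => hi) (by simp) ?_
    intro i hi s' e6 hr ha hinv x y
    generalize hz : (⟨i, hi⟩ : Fin n) = z
    obtain rfl : i = z := congrArg Fin.val hz
    rw [Cmd.den, setCell_arr]
    simp only [Expr.eval, pairIndex, e6, (hr 9 (by decide)).trans hw,
      (hr 0 (by decide)).trans h.reg_zero, mem_pairSet_update]
    by_cases hxy : x = w ∧ y = z
    · simp [hxy]
    · rw [if_neg hxy, hinv x y]
      refine or_congr_right (and_congr_right fun hx => ?_)
      have : (y : ℕ) ≠ z := fun e => hxy ⟨hx, Fin.ext e⟩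
      omega
  rw [addStar, Cmd.den_seq]
  have r0 := Cmd.den_reg (.each 6 (.mark 1 (pairIndex 9 6) (.lit 1))) (s := s) (r := 0) (by decide)
  have r9 := Cmd.den_reg (.each 6 (.mark 1 (pairIndex 9 6) (.lit 1))) (s := s) (r := 9) (by decide)
  have a0 := Cmd.den_arr (.each 6 (.mark 1 (pairIndex 9 6) (.lit 1))) (s := s) (a := 0) (by decide)
  have a3 := Cmd.den_arr (.each 6 (.mark 1 (pairIndex 9 6) (.lit 1))) (s := s) (a := 3) (by decide)
  generalize (Cmd.each 6 (.mark 1 (pairIndex 9 6) (.lit 1))).den s = s₁ at star r0 r9 a0 a3 ⊢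
  have h₁ : Holds I s₁ := h.of_eq r0 a0
  rw [← a3]
  constructor
  · rw [Cmd.den_arr _ (by decide), star]
    simp
  let Inv : ℕ → ℕ → State → Prop := fun i j s' => ∀ x y : Fin n,
    (x, y) ∈ pairSet n (s'.arr 3) ↔ (x, y) ∈ pairSet n (s₁.arr 3) ∧
      (((x : ℕ) < i ∨ (x : ℕ) = i ∧ (y : ℕ) < j) → w ∉ I.safe x y)
  suffices Inv n 0 (Cmd.den (.each 1 (.each 2 (.mark 3 (pairIndex 1 2)
      (.times (.cell 3 (pairIndex 1 2)) (.equal (inSafe 9) (.lit 0)))))) s₁) by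
    simpa using this x y
  refine Cmd.den_each_each Inv (by decide) (by decide) (by decide) h₁.reg_zero
    (fun _ _ _ _ hi => hi) (fun _ _ _ _ hi => hi) (by simp [Inv]) ?_ ?_
  · intro i s' hi x y
    rw [hi x y]
    have := y.2
    refine and_congr_right fun _ => imp_congr_left ?_
    omega
  intro u v s₂ e1 e2 hr ha hinv x y
  have h₂ : HoldsAt I u v s₂ := ⟨h₁.of_eq (hr 0 (by decide)) (ha 0 (by decide)), e1, e2⟩
  have e9 : s₂.reg 9 = w := ((hr 9 (by decide)).trans r9).trans hw
  have cond : (Expr.times (.cell 3 (pairIndex 1 2)) (.equal (inSafe 9) (.lit 0))).eval s₂ ≠ 0 ↔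
      (u, v) ∈ pairSet n (s₂.arr 3) ∧ w ∉ I.safe u v := by
    rw [← h₂.eval_inSafe e9]
    simp only [Expr.eval, mul_ne_zero_iff, pairIndex, h₂.reg_zero, e1, e2, mem_pairSet]
    split_ifs <;> simp_all
  rw [Cmd.den, setCell_arr, show (pairIndex 1 2).eval s₂ = u * n + v by
    simp [pairIndex, Expr.eval, h₂.reg_zero, e1, e2], mem_pairSet_update]
  by_cases hxy : x = u ∧ y = v
  · obtain ⟨rfl, rfl⟩ := hxy
    have := hinv x y
    simp_all [Nat.pos_iff_ne_zero]
  · rw [if_neg hxy, hinv x y]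
    refine and_congr_right fun _ => imp_congr_left ?_
    rw [Fin.ext_iff, Fin.ext_iff] at hxy
    omega

/-- Each safe set contains the endpoints of its pair, so a maximal count of zero means that no
recorded pair is left. -/
theorem starRound_spec (h : Holds I s) :
    let D := pairSet n (s.arr 1)
    let N := pairSet n (s.arr 3)
    let D' := pairSet n ((starRound.den s).arr 1)
    let N' := pairSet n ((starRound.den s).arr 3)
    (N = ∅ ∧ D' = D ∧ N' = N) ∨
      ∃ w, 0 < hits I N w ∧ (∀ w', hits I N w' ≤ hits I N w) ∧
        (∀ x y, (x, y) ∈ D' ↔ (x, y) ∈ D ∨ x = w) ∧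
        (∀ x y, (x, y) ∈ N' ↔ (x, y) ∈ N ∧ w ∉ I.safe x y) := by
  intro D N D' N'
  obtain ⟨hmax, hex⟩ := findBest_spec h
  have r0 := Cmd.den_reg findBest (s := s) (r := 0) (by decide)
  have ha := fun a => Cmd.den_arr findBest (s := s) (a := a)
    (by simp [findBest, countHits, Cmd.arrs])
  simp only [D', N', starRound, Cmd.den_seq]
  generalize findBest.den s = s₁ at hmax hex r0 ha ⊢
  have h₁ : Holds I s₁ := h.of_eq r0 (ha 0)
  rw [Cmd.den]
  have e8 : (Expr.reg 8).eval s₁ = s₁.reg 8 := rfl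
  by_cases hb : s₁.reg 8 = 0
  · left
    rw [if_neg (by simpa [e8] using hb), ha, ha]
    refine ⟨?_, rfl, rfl⟩
    rw [Finset.eq_empty_iff_forall_notMem]
    rintro ⟨u, v⟩ huv
    classical
    have := hmax u
    rw [hb, Nat.le_zero, hits, Finset.card_eq_zero, Finset.filter_eq_empty_iff] at this
    exact this huv (I.left_mem u v)
  · right
    obtain ⟨w, e9, hw⟩ := hex hb
    rw [if_pos (by rwa [e8])]
    refine ⟨w, (Nat.pos_of_ne_zero hb).trans_le hw, fun w' => (hmax w').trans hw, fun x y => ?_,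
      fun x y => ?_⟩
    · rw [(addStar_spec h₁ e9 x y).1, ha]
    · rw [(addStar_spec h₁ e9 x y).2, ha]

theorem rpow_third_le_of_thick (h : Thick I u v) :
    open Classical in (n : ℝ) ^ (1 / 3 : ℝ) ≤ (Finset.card {w | w ∈ I.safe u v} : ℝ) := by
  classical
  have h1 : (n : ℝ) ≤ (Finset.card {w | w ∈ I.safe u v} : ℝ) ^ 3 := by exact_mod_cast h.le
  calc (n : ℝ) ^ (1 / 3 : ℝ) ≤ ((Finset.card {w | w ∈ I.safe u v} : ℝ) ^ 3) ^ (1 / 3 : ℝ) :=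
        Real.rpow_le_rpow (by positivity) h1 (by norm_num)
    _ = _ := by
        rw [← Real.rpow_natCast, ← Real.rpow_mul (by positivity)]
        norm_num

/-- The vertex in most safe sets of thick pairs is in a fraction `n ^ (-2 / 3)` of them. -/
theorem card_le_mul_hits {N : Finset (Fin n × Fin n)} (hN : ∀ p ∈ N, Thick I p.1 p.2) {w : Fin n}
    (hw : ∀ w', hits I N w' ≤ hits I N w) :
    (N.card : ℝ) ≤ (n : ℝ) ^ (2 / 3 : ℝ) * hits I N w := by
  classical
  have hn : (0 : ℝ) < n := by exact_mod_cast w.pos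
  -- Incidences between vertices and safe sets of pairs in `N` are counted in two ways.
  have h1 : ∑ w', hits I N w' = ∑ p ∈ N, Finset.card {w | w ∈ I.safe p.1 p.2} := by
    simp_rw [hits, Finset.card_filter]
    exact Finset.sum_comm
  have h2 : ∑ w', hits I N w' ≤ n * hits I N w := by
    simpa using Finset.sum_le_card_nsmul Finset.univ _ _ fun w' _ => hw w'
  have h3 : (N.card : ℝ) * (n : ℝ) ^ (1 / 3 : ℝ) ≤ n * hits I N w := by
    calc (N.card : ℝ) * (n : ℝ) ^ (1 / 3 : ℝ)
        ≤ ∑ p ∈ N, (Finset.card {w | w ∈ I.safe p.1 p.2} : ℝ) := by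
          simpa using Finset.card_nsmul_le_sum N _ _ fun p hp => rpow_third_le_of_thick (hN p hp)
      _ ≤ n * hits I N w := by exact_mod_cast h1 ▸ h2
  have h4 : (n : ℝ) = (n : ℝ) ^ (2 / 3 : ℝ) * (n : ℝ) ^ (1 / 3 : ℝ) := by
    rw [← Real.rpow_add hn]
    norm_num
  have h5 : 0 < (n : ℝ) ^ (1 / 3 : ℝ) := by positivity
  refine le_of_mul_le_mul_right ?_ h5
  calc _ ≤ _ := h3
    _ = _ := by nth_rw 1 [h4]; ring

/-- The situation after stars at the vertices of `W` have been added to `D₀`, where `N` is the set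
of thick pairs not yet connected and `k` is the number of rounds that added a star. -/
structure Covered (I : Instance (Fin n)) (D₀ D N : Finset (Fin n × Fin n)) (W : Finset (Fin n))
    (k : ℕ) : Prop where
  subset : D₀ ⊆ D
  star : ∀ w ∈ W, ∀ y, (w, y) ∈ D
  mem_or : ∀ x y, (x, y) ∈ D → (x, y) ∈ D₀ ∨ x ∈ W
  covered : ∀ u v, Thick I u v → (u, v) ∈ N ∨ ∃ w ∈ W, w ∈ I.safe u v
  thick : ∀ p ∈ N, Thick I p.1 p.2
  card_W : W.card ≤ k
  card_N : (N.card : ℝ) ≤ (n : ℝ) ^ 2 * (1 - 1 / (n : ℝ) ^ (2 / 3 : ℝ)) ^ k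
  le_log : (k : ℝ) ≤ 2 * (n : ℝ) ^ (2 / 3 : ℝ) * Real.log n + 1

/-- From `1 - 1 / r ≤ exp (-1 / r)` the hypothesis gives `1 ≤ n ^ 2 * exp (-k / r)`; take
logarithms. -/
theorem le_log_of_one_le {n k : ℕ} {r : ℝ} (hn : 1 ≤ n) (hr : 1 ≤ r)
    (h : 1 ≤ (n : ℝ) ^ 2 * (1 - 1 / r) ^ k) : (k : ℝ) ≤ 2 * r * Real.log n := by
  have hr0 : 0 < r := by linarith
  have h0 : 0 ≤ 1 - 1 / r := by
    rw [sub_nonneg, div_le_one hr0]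
    exact hr
  have h1 : (1 - 1 / r) ^ k ≤ Real.exp (-(k / r)) := by
    calc (1 - 1 / r) ^ k ≤ Real.exp (-(1 / r)) ^ k :=
          pow_le_pow_left₀ h0 (by linarith [Real.add_one_le_exp (-(1 / r))]) k
      _ = _ := by rw [← Real.exp_nat_mul]; congr 1; ring
  have hn0 : (0 : ℝ) < n := by exact_mod_cast hn
  have h2 : 1 ≤ (n : ℝ) ^ 2 * Real.exp (-(k / r)) :=
    h.trans (mul_le_mul_of_nonneg_left h1 (by positivity))
  have h3 := Real.log_nonneg h2
  rw [Real.log_mul (by positivity) (Real.exp_pos _).ne', Real.log_pow, Real.log_exp] at h3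
  have h4 : (k : ℝ) / r ≤ 2 * Real.log n := by push_cast at h3; linarith
  rw [div_le_iff₀ hr0] at h4
  linarith

theorem card_filter_add_hits {N N' : Finset (Fin n × Fin n)} {w : Fin n}
    (hN' : ∀ x y, (x, y) ∈ N' ↔ (x, y) ∈ N ∧ w ∉ I.safe x y) :
    N'.card + hits I N w = N.card := by
  classical
  have : N' = {p ∈ N | ¬ w ∈ I.safe p.1 p.2} := by
    ext ⟨x, y⟩
    simp [hN']
  rw [this, hits, add_comm]
  exact Finset.card_filter_add_card_filter_not _

theorem Covered.addStar {D₀ D N D' N' : Finset (Fin n × Fin n)} {W : Finset (Fin n)} {k : ℕ}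
    (h : Covered I D₀ D N W k) {w : Fin n} (hpos : 0 < hits I N w)
    (hmax : ∀ w', hits I N w' ≤ hits I N w) (hD' : ∀ x y, (x, y) ∈ D' ↔ (x, y) ∈ D ∨ x = w)
    (hN' : ∀ x y, (x, y) ∈ N' ↔ (x, y) ∈ N ∧ w ∉ I.safe x y) :
    Covered I D₀ D' N' (insert w W) (k + 1) := by
  have hn : 1 ≤ n := w.pos
  have hr : 1 ≤ (n : ℝ) ^ (2 / 3 : ℝ) := Real.one_le_rpow (by exact_mod_cast hn) (by norm_num)
  have hcard := card_filter_add_hits hN'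
  have hcard' : (N'.card : ℝ) + hits I N w = N.card := by exact_mod_cast hcard
  have hfrac := card_le_mul_hits h.thick hmax
  refine ⟨fun ⟨x, y⟩ hxy => (hD' x y).2 (.inl (h.subset hxy)), ?_, ?_, ?_, ?_, ?_, ?_, ?_⟩
  · intro z hz y
    rw [hD']
    rcases Finset.mem_insert.1 hz with rfl | hz
    · exact .inr rfl
    · exact .inl (h.star z hz y)
  · intro x y hxy
    rcases (hD' x y).1 hxy with hxy | rfl
    · exact (h.mem_or x y hxy).imp_right (Finset.mem_insert_of_mem)
    · exact .inr (Finset.mem_insert_self _ _)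
  · intro u v huv
    rcases h.covered u v huv with hN | ⟨z, hz, hzuv⟩
    · by_cases hw : w ∈ I.safe u v
      · exact .inr ⟨w, Finset.mem_insert_self _ _, hw⟩
      · exact .inl ((hN' u v).2 ⟨hN, hw⟩)
    · exact .inr ⟨z, Finset.mem_insert_of_mem hz, hzuv⟩
  · exact fun ⟨x, y⟩ hp => h.thick _ ((hN' x y).1 hp).1
  · exact (Finset.card_insert_le _ _).trans (Nat.succ_le_succ h.card_W)
  · have h0 : 0 ≤ 1 - 1 / (n : ℝ) ^ (2 / 3 : ℝ) := by
      rw [sub_nonneg, div_le_one (by linarith)]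
      exact hr
    have h1 : (N.card : ℝ) * (1 / (n : ℝ) ^ (2 / 3 : ℝ)) ≤ hits I N w := by
      rw [mul_one_div, div_le_iff₀ (by linarith)]
      linarith
    calc (N'.card : ℝ) ≤ N.card * (1 - 1 / (n : ℝ) ^ (2 / 3 : ℝ)) := by linarith
      _ ≤ _ := mul_le_mul_of_nonneg_right h.card_N h0
      _ = _ := by ring
  -- Before this round `N` was nonempty, so the logarithmic bound holds for `k`; the present round
  -- accounts for the `+ 1`.
  · have h1 : (1 : ℝ) ≤ N.card := by exact_mod_cast (by omega : 1 ≤ N.card)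
    push_cast
    linarith [le_log_of_one_le hn hr (h1.trans h.card_N)]

theorem addStars_spec (h : Holds I s)
    (hN : ∀ u v, (u, v) ∈ pairSet n (s.arr 3) ↔ Thick I u v) (hn : 2 ≤ n) :
    ∃ W k, Covered I (pairSet n (s.arr 1)) (pairSet n ((addStars.den s).arr 1)) ∅ W k := by
  let Inv : ℕ → ℕ → State → Prop := fun i j s' =>
    -- Every round started with a nonempty set discards at least one of the at most `n * n` recorded
    -- pairs, so `n * n` rounds exhaust them.
    (pairSet n (s'.arr 3) = ∅ ∨ (pairSet n (s'.arr 3)).card + (i * n + j) ≤ n * n) ∧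
    ∃ W k, Covered I (pairSet n (s.arr 1)) (pairSet n (s'.arr 1)) (pairSet n (s'.arr 3)) W k
  have card_le : (pairSet n (s.arr 3)).card ≤ n * n := by
    simpa using Finset.card_le_univ (pairSet n (s.arr 3))
  have key : Inv n 0 (addStars.den s) := by
    refine Cmd.den_each_each Inv (by decide) (by decide) (by decide) h.reg_zero
      (fun _ _ _ _ hi => hi) (fun _ _ _ _ hi => hi) ⟨.inr (by simpa using card_le), ∅, 0, ?_⟩ ?_ ?_
    · refine ⟨subset_rfl, by simp, fun _ _ => .inl, fun u v huv => .inl ((hN u v).2 huv),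
        fun p hp => (hN p.1 p.2).1 hp, by simp, ?_, ?_⟩
      · rw [pow_zero, mul_one, sq]
        exact_mod_cast card_le
      · have : 0 ≤ Real.log n := Real.log_natCast_nonneg n
        rw [Nat.cast_zero]
        positivity
    · rintro i s' ⟨hi, hc⟩
      exact ⟨hi.imp_right fun h => by rw [add_mul]; omega, hc⟩
    · rintro i j s₁ - - hr ha ⟨hcount, W, k, hc⟩
      have h₁ : Holds I s₁ := h.of_eq (hr 0 (by decide)) (ha 0 (by decide))
      rcases starRound_spec h₁ with ⟨h1, h2, h3⟩ | ⟨w, hpos, hmax, hD', hN'⟩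
      · refine ⟨.inl (h3.trans h1), W, k, ?_⟩
        rw [h2, h3]
        exact hc
      · refine ⟨hcount.imp (fun h0 => ?_) (fun hle => ?_), _, _, hc.addStar hpos hmax hD' hN'⟩
        · simp [h0, hits] at hpos
        · have := card_filter_add_hits hN'
          omega
  obtain ⟨h1, W, k, h2⟩ := key
  have h3 : pairSet n ((addStars.den s).arr 3) = ∅ :=
    h1.elim id fun h => Finset.card_eq_zero.1 (by omega)
  rw [h3] at h2
  exact ⟨W, k, h2⟩

/-! ### The approximation guarantee -/

theorem le_two_mul_ncard_edgeSet {G : SimpleGraph (Fin n)} (hn : 2 ≤ n)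
    (hG : SafelyConnected I G) : n ≤ 2 * G.edgeSet.ncard := by
  have : Nonempty (Fin n) := ⟨⟨0, by omega⟩⟩
  have hconn : G.Connected := ⟨fun u v => ⟨(hG.2 u v).choose⟩⟩
  have h := hconn.card_vert_le_card_edgeSet_add_one
  rw [Nat.card_coe_set_eq, Nat.card_fin] at h
  omega

theorem exists_safelyConnected_ncard_eq_opt (hI : I.graph = ⊤) :
    ∃ G, SafelyConnected I G ∧ G.edgeSet.ncard = opt I :=
  Nat.sInf_mem (s := {m | ∃ H, SafelyConnected I H ∧ H.edgeSet.ncard = m})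
    ⟨_, ⊤, safelyConnected_top I hI, rfl⟩

theorem main_spec (hn : 2 ≤ n) (hI : I.graph = ⊤) :
    SafelyConnected I (output n (main.den (initial I))) ∧
      ((output n (main.den (initial I))).edgeSet.ncard : ℝ) ≤
        10 * (n : ℝ) ^ (2 / 3 : ℝ) * Real.log n * opt I := by
  have hempty : pairSet n ((initial I).arr 1) = ∅ := by
    ext ⟨x, y⟩
    simp [initial]
  obtain ⟨hN, hthin, heco⟩ := treatPairs_spec initial_holds hempty
  have hs : Holds I (treatPairs.den (initial I)) :=
    initial_holds.of_eq (Cmd.den_reg _ (by decide)) (Cmd.den_arr _ (by decide))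
  obtain ⟨W, k, hc⟩ := addStars_spec hs hN hn
  rw [output_eq, main, Cmd.den_seq]
  generalize pairSet n ((treatPairs.den (initial I)).arr 1) = D₀ at hthin heco hc
  generalize pairSet n ((addStars.den (treatPairs.den (initial I))).arr 1) = D at hc
  constructor
  · refine ⟨hI ▸ le_top, fun u v => ConnectedWithin.exists_isPath ?_⟩
    by_cases ht : Thick I u v
    · obtain ⟨w, hw, hwS⟩ := (hc.covered u v ht).resolve_left (Finset.notMem_empty _)
      -- The route goes from `u` to the centre `w` and on to `v`; `ConnectedWithin.step` also allows
      -- `w` to be an endpoint.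
      exact ((connectedWithin_self (I.left_mem u v)).step hwS (.inr (hc.star w hw u))).step
        (I.right_mem u v) (.inl (hc.star w hw v))
    · exact (hthin u v ht).mono (graphOf_mono hc.subset)
  · obtain ⟨G, hG, hopt⟩ := exists_safelyConnected_ncard_eq_opt hI
    have h1 : (D₀.card : ℝ) ≤ (n : ℝ) ^ (2 / 3 : ℝ) * opt I := by
      refine (heco G hG).trans (mul_le_mul_of_nonneg_left ?_ (by positivity))
      rw [← hopt]
      exact_mod_cast Set.ncard_le_ncard (SimpleGraph.edgeSet_mono inf_le_left) (Set.toFinite _)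
    have h2 : (n : ℝ) ≤ 2 * opt I := by
      rw [← hopt]
      exact_mod_cast le_two_mul_ncard_edgeSet hn hG
    have h3 : D.card ≤ D₀.card + k * n := by
      have hsub : D ⊆ D₀ ∪ W ×ˢ Finset.univ := by
        rintro ⟨x, y⟩ hxy
        simpa using hc.mem_or x y hxy
      have := (Finset.card_le_card hsub).trans (Finset.card_union_le _ _)
      rw [Finset.card_product, Finset.card_univ, Fintype.card_fin] at this
      exact this.trans (Nat.add_le_add_left (Nat.mul_le_mul_right _ hc.card_W) _)
    have h4 : ((graphOf D).edgeSet.ncard : ℝ) ≤ D₀.card + k * n := by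
      exact_mod_cast (ncard_edgeSet_graphOf_le D).trans h3
    have hr : 1 ≤ (n : ℝ) ^ (2 / 3 : ℝ) :=
      Real.one_le_rpow (by exact_mod_cast (by omega : 1 ≤ n)) (by norm_num)
    have hL : 1 / 2 ≤ Real.log n :=
      (by linarith [Real.log_two_gt_d9] : 1 / 2 ≤ Real.log 2).trans
        (Real.log_le_log two_pos (by exact_mod_cast hn))
    have h5 := hc.le_log
    generalize (n : ℝ) ^ (2 / 3 : ℝ) = r at *
    generalize Real.log n = L at *
    -- With `1 / 2 ≤ L` and `1 ≤ r`, the terms `r` and `2` are at most `2 * r * L` and `4 * r * L`;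
    -- together with `4 * r * L` this gives the constant `10`.
    have hrL : r ≤ 2 * (r * L) := by nlinarith
    have ho : (0 : ℝ) ≤ opt I := Nat.cast_nonneg _
    calc _ ≤ _ := h4
      _ ≤ r * opt I + (2 * r * L + 1) * (2 * opt I) :=
        add_le_add h1 (mul_le_mul h5 h2 (Nat.cast_nonneg _) (by nlinarith))
      _ = (r + 4 * (r * L) + 2) * opt I := by ring
      _ ≤ (10 * r * L) * opt I := mul_le_mul_of_nonneg_right (by linarith) ho

end

instance : MeasureTheory.IsProbabilityMeasure coinLaw := by
  unfold coinLaw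
  infer_instance

end ConstrainedConnectivity

theorem mainTheorem8 :
    ∃ (P : ConstrainedConnectivity.Program) (C : ℝ) (k : ℕ),
      ∀ n : ℕ, 2 ≤ n →
      ∀ I : ConstrainedConnectivity.Instance (Fin n), I.graph = ⊤ →
        (∀ ω : ℕ → Bool, ∃ (t : ℕ) (s : ConstrainedConnectivity.State),
          ConstrainedConnectivity.Exec ω P (ConstrainedConnectivity.initial I) t s ∧
          (t : ℝ) ≤ C * (n : ℝ) ^ 6 * Real.log n ^ k) ∧
        1 - 1 / (n : ℝ) ≤ ConstrainedConnectivity.coinLaw.real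
          {ω : ℕ → Bool | ∃ (t : ℕ) (s : ConstrainedConnectivity.State),
            ConstrainedConnectivity.Exec ω P (ConstrainedConnectivity.initial I) t s ∧
            ConstrainedConnectivity.SafelyConnected I (ConstrainedConnectivity.output n s) ∧
            ((ConstrainedConnectivity.output n s).edgeSet.ncard : ℝ) ≤
              C * (n : ℝ) ^ (2 / 3 : ℝ) * Real.log n ^ k *
                (ConstrainedConnectivity.opt I : ℝ)} := by
  obtain ⟨C, hC⟩ := ConstrainedConnectivity.Cmd.exec_initial
    ConstrainedConnectivity.Algorithm.main ConstrainedConnectivity.Algorithm.main_wellFormed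
    ConstrainedConnectivity.Algorithm.zero_notMem_regs_main
    ConstrainedConnectivity.Algorithm.depth_main
  refine ⟨ConstrainedConnectivity.Algorithm.main.compile, max C 10, 1, fun n hn I hI => ?_⟩
  have hlog : 0 ≤ Real.log n := Real.log_natCast_nonneg n
  constructor
  · intro ω
    obtain ⟨t, et, ht⟩ := hC n hn I ω
    refine ⟨t, _, et, ht.trans ?_⟩
    rw [pow_one]
    gcongr
    exact le_max_left _ _
  · obtain ⟨hsafe, hcard⟩ := ConstrainedConnectivity.main_spec hn hI
    -- The program flips no coins: the guarantee holds for every outcome, so the event has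
    -- probability one.
    rw [Set.eq_univ_of_forall (s := {ω : ℕ → Bool | _}) fun ω => ?_]
    · rw [MeasureTheory.probReal_univ]
      have : (0 : ℝ) ≤ 1 / n := by positivity
      linarith
    · obtain ⟨t, et, -⟩ := hC n hn I ω
      refine ⟨t, _, et, hsafe, hcard.trans ?_⟩
      rw [pow_one]
      gcongr
      exact le_max_right _ _
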